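/- For a positive integer $q$, $\chi$ denotes a Dirichlet character modulo $q$, and $\chi_0$ the principal one. (i) There exist absolute constants $c>0$ and $C>0$ such that for every $A>0$ there is $q_0=q_0(A)$ with the following property. Let $q\ge q_0$ be an integer, let $\tau$ be a real number with $(\log\log q)^{-A}\le\tau\le(\log\log q)^{A}$, put $\eta=\tau+1/\tau$, and define $x>0$ by $\log x=\tau\sqrt{\log q\,\log\log q}$. Then there is a non-principal character $\chi \pmod q$ with $$\frac1{\sqrt x}\Bigl|\sum_{n\le x}\chi(n)\Bigr|\ \ge\ C\exp\Bigl(c\,\frac{1+\log(\eta\tau)}{\eta}\sqrt{\frac{\log q}{\log\log q}}\Bigr).$$ (ii) There exist absolute constants $c>0$ and $C>0$ such that for every integer $q\ge3$ the maximum below, over all non-principal $\chi\pmod q$ and all real $x\ge1$, exists and satisfies $$\max_{\chi\ne\chi_0}\ \max_{x\ge1}\ \frac1{\sqrt x}\Bigl|\sum_{n\le x}\chi(n)\Bigr|\ \ge\ C\exp\Bigl(c\sqrt{\frac{\log q}{\log\log q}}\Bigr).$$ -/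

import Mathlib

/-- The character sum `∑_{n ≤ x} χ(n)` over the positive integers `n ≤ x`, for real `x`. -/
noncomputable def charSum {q : ℕ} (χ : DirichletCharacter ℂ q) (x : ℝ) : ℂ :=
  ∑ n ∈ Finset.Icc 1 ⌊x⌋₊, χ (n : ZMod q)

/-- The set of all values `|∑_{n ≤ x} χ(n)| / √x`, where `χ` runs over the non-principal
characters modulo `q` and `x` over the real numbers `x ≥ 1`. -/
def normalizedCharSums (q : ℕ) : Set ℝ :=
  {r | ∃ χ : DirichletCharacter ℂ q, χ ≠ 1 ∧ ∃ x : ℝ, 1 ≤ x ∧ r = ‖charSum χ x‖ / √x}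

/-! The proof is a resonance argument. Take sets `A`, `B` of integers below `q` and prime to `q`,
put F(χ) = ∑_{m∈A} χ(m) and G(χ) = ∑_{l∈B} χ(l), and average F(χ)·conj G(χ)·∑_{n≤x} χ(n) over all χ.
Orthogonality counts solutions of mn ≡ l (mod q); keeping only mn = l gives at least φ(q)|B|h if
every l ∈ B has h divisors m ∈ A with l/m ≤ x. If the non-principal sums are at most Y,
Cauchy–Schwarz bounds the average by φ(q)Y√(|A||B|) plus the principal term, which is harmless when
`A`, `B` and x are small powers of q. Hence Y + 1 ≥ h√(|B|/|A|) (`resonance_inequality`).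

Elements of `B` have K_i primes in the block (16^i, 16^(i+1)], elements of `A` have K_i - k_i. With
M_i primes in the block and U_i = 16^(i+1), |B|h²/|A| is at least ∏ (M_i K_i/(2k_i²))^{k_i}. Taking
K_i ≍ i·k_i² makes each base at least e²U_i, so Y + 1 ≥ e^{∑k_i}·√(∏U_i^{k_i})
(`charSum_bound_ge_of_blocks`). If ∏U_i^{k_i} nearly equals x, the gain over √x is about e^{∑k_i}.

It remains to make ∑k_i large with ∑ i·k_i ≍ log x and ∑ i²k_i² at most a small multiple of log q.
Lagrange multipliers suggest k_i ≈ a/i² on I ≤ i < J: then ∑k_i ≍ a/I, log x ≍ a·log(J/I), and the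
size condition is a² ≪ I log q. With t = max(τ, 1), the choices J/I ≍ t and I ≍ t² log log q/(1 +
log t)² yield (i). The case τ = 1 yields (ii), where the maximum exists because non-principal sums
are bounded by q. -/

/-! ### Orthogonality and the resonance inequality -/

/-- Orthogonality of Dirichlet characters, with complex conjugation in place of inversion. -/
theorem sum_dirichletCharacter_mul_star {q : ℕ} [NeZero q] (a : ZMod q) {b : ZMod q}
    (hb : IsUnit b) :
    ∑ χ : DirichletCharacter ℂ q, χ a * star (χ b) = if a = b then (q.totient : ℂ) else 0 := by
  have h := DirichletCharacter.sum_char_inv_mul_char_eq ℂ hb a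
  simp only [eq_comm (a := b)] at h
  rw [← h]
  refine Finset.sum_congr rfl fun χ _ => ?_
  rw [mul_comm]
  congr 1
  have h1 : χ b * χ b⁻¹ = 1 := by
    rw [← map_mul, ZMod.mul_inv_of_unit b hb, map_one]
  have h2 : ‖χ b‖ = 1 := by
    obtain ⟨u, rfl⟩ := hb
    exact DirichletCharacter.unit_norm_eq_one χ u
  have h3 : χ b * star (χ b) = 1 := by
    have := Complex.mul_conj' (χ b)
    rw [h2] at this
    simpa using this
  have h0 : χ b ≠ 0 := by
    intro h
    simp [h] at h2
  exact mul_left_cancel₀ h0 (h3.trans h1.symm)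

theorem zmod_natCast_inj_of_lt {q a b : ℕ} (ha : a < q) (hb : b < q) :
    (a : ZMod q) = (b : ZMod q) ↔ a = b := by
  rw [ZMod.natCast_eq_natCast_iff', Nat.mod_eq_of_lt ha, Nat.mod_eq_of_lt hb]

theorem isUnit_natCast_zmod {q a : ℕ} (h : a.Coprime q) : IsUnit (a : ZMod q) :=
  (ZMod.isUnit_iff_coprime a q).2 h

/-- The second moment over all characters of a sum of distinct residues prime to the modulus. -/
theorem sum_norm_sq_dirichletCharacter {q : ℕ} [NeZero q] {A : Finset ℕ}
    (hA : ∀ m ∈ A, m < q ∧ m.Coprime q) :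
    ∑ χ : DirichletCharacter ℂ q, ‖∑ m ∈ A, χ (m : ZMod q)‖ ^ 2 = q.totient * A.card := by
  have key : ∑ χ : DirichletCharacter ℂ q,
      (∑ m ∈ A, χ (m : ZMod q)) * star (∑ m ∈ A, χ (m : ZMod q)) = q.totient * A.card := by
    simp only [star_sum, Finset.sum_mul_sum]
    rw [Finset.sum_comm]
    have : ∀ m ∈ A, ∑ χ : DirichletCharacter ℂ q, ∑ l ∈ A, χ (m : ZMod q) * star (χ (l : ZMod q))
        = q.totient := by
      intro m hm
      rw [Finset.sum_comm]
      have : ∀ l ∈ A, ∑ χ : DirichletCharacter ℂ q, χ (m : ZMod q) * star (χ (l : ZMod q))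
          = if m = l then (q.totient : ℂ) else 0 := by
        intro l hl
        rw [sum_dirichletCharacter_mul_star _ (isUnit_natCast_zmod (hA l hl).2)]
        simp only [zmod_natCast_inj_of_lt (hA m hm).1 (hA l hl).1]
      rw [Finset.sum_congr rfl this, Finset.sum_ite_eq, if_pos hm]
    rw [Finset.sum_congr rfl this, Finset.sum_const, nsmul_eq_mul, mul_comm]
  have h2 : ∀ z : ℂ, ((‖z‖ ^ 2 : ℝ) : ℂ) = z * star z := by
    intro z
    rw [← starRingEnd_apply, Complex.mul_conj', Complex.ofReal_pow]
  have : ((∑ χ : DirichletCharacter ℂ q, ‖∑ m ∈ A, χ (m : ZMod q)‖ ^ 2 : ℝ) : ℂ)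
      = ((q.totient * A.card : ℝ) : ℂ) := by
    rw [Complex.ofReal_sum, Finset.sum_congr rfl fun χ _ => h2 _, key]
    push_cast
    rfl
  exact_mod_cast this

theorem norm_charSum_le {q : ℕ} (χ : DirichletCharacter ℂ q) {x : ℝ} (hx : 0 ≤ x) :
    ‖charSum χ x‖ ≤ x := by
  unfold charSum
  calc _ ≤ ∑ n ∈ Finset.Icc 1 ⌊x⌋₊, ‖χ (n : ZMod q)‖ := norm_sum_le _ _
    _ ≤ ∑ n ∈ Finset.Icc 1 ⌊x⌋₊, (1 : ℝ) := Finset.sum_le_sum fun n _ => χ.norm_le_one _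
    _ = ⌊x⌋₊ := by simp
    _ ≤ x := Nat.floor_le hx

/-- The resonance inequality: if every `l ∈ B` has at least `h` divisors `m ∈ A` with `l / m ≤ x`,
then the twisted first moment of `charSum χ x` is at least `φ(q) |B| h`, whereas a uniform bound
`Y` over the non-principal characters bounds it from above. -/
theorem resonance_inequality {q : ℕ} [NeZero q] {A B : Finset ℕ} {x Y : ℝ} {h : ℕ}
    (hA : ∀ m ∈ A, m < q ∧ m.Coprime q) (hB : ∀ m ∈ B, m < q ∧ m.Coprime q)
    (hB0 : ∀ l ∈ B, l ≠ 0) (hx : 0 ≤ x) (hY : 0 ≤ Y)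
    (hS : ∀ χ : DirichletCharacter ℂ q, χ ≠ 1 → ‖charSum χ x‖ ≤ Y)
    (hdiv : ∀ l ∈ B, h ≤ (A.filter fun m => m ∣ l ∧ (l : ℝ) ≤ m * x).card) :
    (q.totient : ℝ) * (B.card * h) ≤
      Y * (q.totient * √(A.card * B.card)) + A.card * B.card * x := by
  classical
  set F : DirichletCharacter ℂ q → ℂ := fun χ => ∑ m ∈ A, χ (m : ZMod q) with hF
  set G : DirichletCharacter ℂ q → ℂ := fun χ => ∑ m ∈ B, χ (m : ZMod q) with hG
  have hmoment : ∑ χ : DirichletCharacter ℂ q, F χ * star (G χ) * charSum χ x =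
      ((∑ l ∈ B, ∑ m ∈ A, ∑ n ∈ Finset.Icc 1 ⌊x⌋₊,
        if ((m * n : ℕ) : ZMod q) = (l : ZMod q) then (q.totient : ℝ) else 0 : ℝ) : ℂ) := by
    have e : ∀ χ : DirichletCharacter ℂ q, F χ * star (G χ) * charSum χ x =
        ∑ l ∈ B, ∑ m ∈ A, ∑ n ∈ Finset.Icc 1 ⌊x⌋₊,
          χ ((m * n : ℕ) : ZMod q) * star (χ (l : ZMod q)) := by
      intro χ
      have h1 : ∀ l m n : ℕ, χ ((m * n : ℕ) : ZMod q) * star (χ (l : ZMod q)) =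
          χ (m : ZMod q) * (χ (n : ZMod q) * star (χ (l : ZMod q))) := by
        intro l m n
        rw [Nat.cast_mul, map_mul, mul_assoc]
      simp only [h1, ← Finset.mul_sum, ← Finset.sum_mul]
      simp only [hF, hG, charSum, star_sum]
      ring
    simp only [e]
    rw [Finset.sum_comm]
    push_cast
    refine Finset.sum_congr rfl fun l hl => ?_
    rw [Finset.sum_comm]
    refine Finset.sum_congr rfl fun m _ => ?_
    rw [Finset.sum_comm]
    refine Finset.sum_congr rfl fun n _ => ?_
    have := sum_dirichletCharacter_mul_star ((m * n : ℕ) : ZMod q)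
      (isUnit_natCast_zmod (hB l hl).2)
    push_cast at this
    rw [this]
    split_ifs <;> simp
  have hlower : (q.totient : ℝ) * (B.card * h) ≤ ∑ l ∈ B, ∑ m ∈ A, ∑ n ∈ Finset.Icc 1 ⌊x⌋₊,
        if ((m * n : ℕ) : ZMod q) = (l : ZMod q) then (q.totient : ℝ) else 0 := by
    have hl1 : ∀ l ∈ B, (q.totient : ℝ) * h ≤ ∑ m ∈ A, ∑ n ∈ Finset.Icc 1 ⌊x⌋₊,
        if ((m * n : ℕ) : ZMod q) = (l : ZMod q) then (q.totient : ℝ) else 0 := by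
      intro l hl
      calc (q.totient : ℝ) * h ≤
          q.totient * (A.filter fun m => m ∣ l ∧ (l : ℝ) ≤ m * x).card := by
            gcongr
            exact hdiv l hl
        _ = ∑ m ∈ A, if m ∣ l ∧ (l : ℝ) ≤ m * x then (q.totient : ℝ) else 0 := by
            rw [← Finset.sum_filter, Finset.sum_const, nsmul_eq_mul, mul_comm]
        -- Each admissible divisor m contributes the exact solution n = l/m ≤ x; the other solutions
        -- of the congruence are nonnegative and dropped.
        _ ≤ _ := by
            refine Finset.sum_le_sum fun m hm => ?_
            have hnn : ∀ n ∈ Finset.Icc 1 ⌊x⌋₊,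
                0 ≤ if ((m * n : ℕ) : ZMod q) = (l : ZMod q) then (q.totient : ℝ) else 0 := by
              intro n _
              split_ifs <;> positivity
            split_ifs with hc
            · obtain ⟨⟨n, rfl⟩, hle⟩ := hc
              have hz : m * n ≠ 0 := hB0 _ hl
              have hm0 : (0 : ℝ) < m := by
                rcases Nat.eq_zero_or_pos m with h | h
                · simp [h] at hz
                · exact_mod_cast h
              have hn : n ∈ Finset.Icc 1 ⌊x⌋₊ := by
                rw [Finset.mem_Icc]
                constructor
                · rcases Nat.eq_zero_or_pos n with h | h
                  · simp [h] at hz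
                  · exact h
                · apply Nat.le_floor
                  push_cast at hle
                  exact le_of_mul_le_mul_left hle hm0
              refine le_trans ?_ (Finset.single_le_sum hnn hn)
              rw [if_pos rfl]
            · exact Finset.sum_nonneg hnn
    calc (q.totient : ℝ) * (B.card * h) = ∑ l ∈ B, (q.totient : ℝ) * h := by
          rw [Finset.sum_const, nsmul_eq_mul]; ring
      _ ≤ _ := Finset.sum_le_sum hl1
  have hupper : ‖∑ χ : DirichletCharacter ℂ q, F χ * star (G χ) * charSum χ x‖ ≤
      Y * (q.totient * √(A.card * B.card)) + A.card * B.card * x := by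
    -- The assumed bound `Y` says nothing about the principal character, which is estimated
    -- trivially.
    have hterm : ∀ χ : DirichletCharacter ℂ q, ‖F χ * star (G χ) * charSum χ x‖ ≤
        Y * (‖F χ‖ * ‖G χ‖) + if χ = 1 then A.card * B.card * x else 0 := by
      intro χ
      rw [norm_mul, norm_mul, norm_star]
      split_ifs with hχ
      · have b : ∀ s : Finset ℕ, ‖∑ m ∈ s, χ (m : ZMod q)‖ ≤ s.card := by
          intro s
          calc _ ≤ ∑ m ∈ s, ‖χ (m : ZMod q)‖ := norm_sum_le _ _
            _ ≤ ∑ m ∈ s, (1 : ℝ) := Finset.sum_le_sum fun n _ => χ.norm_le_one _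
            _ = s.card := by simp
        have h1 : ‖F χ‖ * ‖G χ‖ * ‖charSum χ x‖ ≤ A.card * B.card * x :=
          mul_le_mul (mul_le_mul (b A) (b B) (norm_nonneg _) (by positivity))
            (norm_charSum_le χ hx) (norm_nonneg _) (by positivity)
        have h2 : 0 ≤ Y * (‖F χ‖ * ‖G χ‖) := by positivity
        linarith
      · rw [add_zero, mul_comm]
        exact mul_le_mul_of_nonneg_right (hS χ hχ) (by positivity)
    have hCS : ∑ χ : DirichletCharacter ℂ q, ‖F χ‖ * ‖G χ‖ ≤ q.totient * √(A.card * B.card) := by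
      refine (Real.sum_mul_le_sqrt_mul_sqrt _ _ _).trans ?_
      rw [sum_norm_sq_dirichletCharacter hA, sum_norm_sq_dirichletCharacter hB,
        ← Real.sqrt_mul (by positivity)]
      rw [show (q.totient * A.card * (q.totient * B.card) : ℝ)
        = (q.totient : ℝ) ^ 2 * (A.card * B.card) by ring, Real.sqrt_mul (by positivity),
        Real.sqrt_sq (by positivity)]
    calc _ ≤ ∑ χ : DirichletCharacter ℂ q, ‖F χ * star (G χ) * charSum χ x‖ := norm_sum_le _ _
      _ ≤ ∑ χ : DirichletCharacter ℂ q, (Y * (‖F χ‖ * ‖G χ‖) +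
            if χ = 1 then A.card * B.card * x else 0) := Finset.sum_le_sum fun χ _ => hterm χ
      _ = Y * ∑ χ : DirichletCharacter ℂ q, ‖F χ‖ * ‖G χ‖ + A.card * B.card * x := by
          rw [Finset.sum_add_distrib, ← Finset.mul_sum, Finset.sum_ite_eq', if_pos (Finset.mem_univ _)]
      _ ≤ _ := by gcongr
  rw [hmoment, Complex.norm_real] at hupper
  exact hlower.trans ((le_abs_self _).trans hupper)

/-! ### Binomial coefficient estimates -/

/-- Consecutive ratios C(M,j)/C(M,j+1) = (j+1)/(M-j) are at most 2K/M for j < K ≤ M/2; multiply k of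
them. -/
theorem choose_mul_pow_le_choose_mul_pow {M K : ℕ} (hM : 2 * K ≤ M) {k : ℕ} (hk : k ≤ K) :
    M.choose (K - k) * M ^ k ≤ M.choose K * (2 * K) ^ k := by
  induction k with
  | zero => simp
  | succ k ih =>
    have ih := ih (by omega)
    obtain ⟨j, rfl⟩ : ∃ j, K = k + 1 + j := ⟨K - (k + 1), by omega⟩
    rw [show k + 1 + j - (k + 1) = j by omega]
    rw [show k + 1 + j - k = j + 1 by omega] at ih
    have h1 := Nat.choose_succ_right_eq M j
    have h2 : M.choose j * M ≤ M.choose (j + 1) * (2 * (k + 1 + j)) :=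
      calc M.choose j * M ≤ M.choose j * (2 * (M - j)) := by gcongr; omega
        _ = 2 * (M.choose (j + 1) * (j + 1)) := by rw [h1]; ring
        _ ≤ 2 * (M.choose (j + 1) * (k + 1 + j)) :=
          Nat.mul_le_mul_left _ (Nat.mul_le_mul_left _ (by omega))
        _ = _ := by ring
    calc M.choose j * M ^ (k + 1) = M.choose j * M * M ^ k := by ring
      _ ≤ M.choose (j + 1) * (2 * (k + 1 + j)) * M ^ k := by gcongr
      _ = M.choose (j + 1) * M ^ k * (2 * (k + 1 + j)) := by ring
      _ ≤ M.choose (k + 1 + j) * (2 * (k + 1 + j)) ^ k * (2 * (k + 1 + j)) := by gcongr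
      _ = _ := by ring

theorem pow_le_choose_mul_pow {K k : ℕ} (hk : k ≤ K) : K ^ k ≤ K.choose k * k ^ k := by
  induction k generalizing K with
  | zero => simp
  | succ k ih =>
    obtain ⟨K, rfl⟩ : ∃ j, K = j + 1 := ⟨K - 1, by omega⟩
    have hk' : k ≤ K := by omega
    have h : (K + 1) ^ k ≤ K.choose k * (k + 1) ^ k := by
      rcases Nat.eq_zero_or_pos k with rfl | hpos
      · simp
      · refine Nat.le_of_mul_le_mul_right (c := k ^ k) ?_ (by positivity)
        calc (K + 1) ^ k * k ^ k = ((K + 1) * k) ^ k := by rw [mul_pow]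
          _ ≤ (K * (k + 1)) ^ k := by gcongr ?_ ^ _; nlinarith
          _ = K ^ k * (k + 1) ^ k := by rw [mul_pow]
          _ ≤ K.choose k * k ^ k * (k + 1) ^ k := by gcongr; exact ih hk'
          _ = _ := by ring
    calc (K + 1) ^ (k + 1) = (K + 1) * (K + 1) ^ k := by ring
      _ ≤ (K + 1) * (K.choose k * (k + 1) ^ k) := by gcongr
      _ = (K + 1) * K.choose k * (k + 1) ^ k := by ring
      _ = (K + 1).choose (k + 1) * (k + 1) * (k + 1) ^ k := by rw [Nat.add_one_mul_choose_eq]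
      _ = _ := by ring

/-- One block's share of |B|h²/|A|: the two preceding bounds give (M/(2K))^k·(K/k)^(2k) =
(MK/(2k²))^k. -/
theorem choose_mul_choose_sq_ge {M K k : ℕ} {W : ℝ} (hM : 2 * K ≤ M) (hk : k ≤ K)
    (hW0 : 0 ≤ W) (hW : 2 * (k : ℝ) ^ 2 * W ≤ M * K) :
    (M.choose (K - k) : ℝ) * W ^ k ≤ M.choose K * (K.choose k : ℝ) ^ 2 := by
  rcases Nat.eq_zero_or_pos k with rfl | hpos
  · simp
  have h1 : (M.choose (K - k) : ℝ) * M ^ k ≤ M.choose K * (2 * K) ^ k := by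
    exact_mod_cast choose_mul_pow_le_choose_mul_pow hM hk
  have h2 : (K : ℝ) ^ k ≤ K.choose k * k ^ k := by
    exact_mod_cast pow_le_choose_mul_pow hk
  have hK : (0 : ℝ) < K := by exact_mod_cast lt_of_lt_of_le hpos hk
  have hk0 : (0 : ℝ) < k := by exact_mod_cast hpos
  refine le_of_mul_le_mul_right (a := (2 * (k : ℝ) ^ 2) ^ k * K ^ k) ?_ (by positivity)
  calc (M.choose (K - k) : ℝ) * W ^ k * ((2 * (k : ℝ) ^ 2) ^ k * K ^ k)
      = (M.choose (K - k) : ℝ) * (2 * (k : ℝ) ^ 2 * W) ^ k * K ^ k := by rw [mul_pow _ W]; ring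
    _ ≤ (M.choose (K - k) : ℝ) * (M * K) ^ k * K ^ k := by gcongr
    _ = (M.choose (K - k) : ℝ) * M ^ k * (K ^ k) ^ 2 := by rw [mul_pow]; ring
    _ ≤ (M.choose K : ℝ) * (2 * K) ^ k * (K.choose k * k ^ k) ^ 2 := by gcongr
    _ = (M.choose K : ℝ) * (K.choose k : ℝ) ^ 2 * ((2 * (k : ℝ) ^ 2) ^ k * K ^ k) := by
      rw [mul_pow, mul_pow, mul_pow, ← pow_mul, ← pow_mul, mul_comm k 2]; ring

/-! ### Resonator sets built from blocks of primes -/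

section BlockProducts

variable {ι : Type*} [Fintype ι] [DecidableEq ι]

/-- The integers having, for each `i`, exactly `K i` prime factors in the block `Q i` (each with
multiplicity one) and no others. -/
def blockProducts (Q : ι → Finset ℕ) (K : ι → ℕ) : Finset ℕ :=
  (Fintype.piFinset fun i => (Q i).powersetCard (K i)).image fun f => ∏ i, ∏ p ∈ f i, p

/-- By unique factorisation the product determines its set of primes, and intersecting with the
disjoint blocks recovers each component. -/
theorem prod_block_injective {Q : ι → Finset ℕ} (hp : ∀ i, ∀ p ∈ Q i, p.Prime)
    (hd : Pairwise fun i j => Disjoint (Q i) (Q j)) {f g : ι → Finset ℕ}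
    (hf : ∀ i, f i ⊆ Q i) (hg : ∀ i, g i ⊆ Q i)
    (h : ∏ i, ∏ p ∈ f i, p = ∏ i, ∏ p ∈ g i, p) : f = g := by
  have key : ∀ f : ι → Finset ℕ, (∀ i, f i ⊆ Q i) →
      (∏ i, ∏ p ∈ f i, p).primeFactors = Finset.univ.biUnion f := by
    intro f hf
    rw [← Finset.prod_biUnion]
    · refine Nat.primeFactors_prod fun p hpm => ?_
      obtain ⟨i, -, hi⟩ := Finset.mem_biUnion.1 hpm
      exact hp i p (hf i hi)
    · intro i _ j _ hij
      exact Finset.disjoint_of_subset_left (hf i) (Finset.disjoint_of_subset_right (hf j) (hd hij))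
  have key2 : ∀ f : ι → Finset ℕ, (∀ i, f i ⊆ Q i) → ∀ i p,
      p ∈ f i ↔ p ∈ Q i ∧ p ∈ (∏ i, ∏ p ∈ f i, p).primeFactors := by
    intro f hf i p
    rw [key f hf]
    constructor
    · intro h
      exact ⟨hf i h, Finset.mem_biUnion.2 ⟨i, Finset.mem_univ _, h⟩⟩
    · rintro ⟨h1, h2⟩
      obtain ⟨j, -, hj⟩ := Finset.mem_biUnion.1 h2
      by_cases hij : i = j
      · rwa [hij]
      · exact absurd (hf j hj) (Finset.disjoint_left.1 (hd hij) h1)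
  funext i
  ext p
  rw [key2 f hf, key2 g hg, h]

theorem mem_blockProducts {Q : ι → Finset ℕ} {K : ι → ℕ} {l : ℕ} :
    l ∈ blockProducts Q K ↔
      ∃ f : ι → Finset ℕ, (∀ i, f i ⊆ Q i ∧ (f i).card = K i) ∧ ∏ i, ∏ p ∈ f i, p = l := by
  simp [blockProducts, Fintype.mem_piFinset, Finset.mem_powersetCard]

theorem card_blockProducts {Q : ι → Finset ℕ} (hp : ∀ i, ∀ p ∈ Q i, p.Prime)
    (hd : Pairwise fun i j => Disjoint (Q i) (Q j)) (K : ι → ℕ) :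
    (blockProducts Q K).card = ∏ i, (Q i).card.choose (K i) := by
  rw [blockProducts, Finset.card_image_of_injOn, Fintype.card_piFinset]
  · simp only [Finset.card_powersetCard]
  · intro f hf g hg h
    simp only [Finset.mem_coe, Fintype.mem_piFinset, Finset.mem_powersetCard] at hf hg
    exact prod_block_injective hp hd (fun i => (hf i).1) (fun i => (hg i).1) h

theorem pos_of_mem_blockProducts {Q : ι → Finset ℕ} (hp : ∀ i, ∀ p ∈ Q i, p.Prime)
    {K : ι → ℕ} {l : ℕ} (hl : l ∈ blockProducts Q K) : 0 < l := by
  obtain ⟨f, hf, rfl⟩ := mem_blockProducts.1 hl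
  exact Finset.prod_pos fun i _ => Finset.prod_pos fun p hpm => (hp i p ((hf i).1 hpm)).pos

theorem coprime_of_mem_blockProducts {Q : ι → Finset ℕ} {q : ℕ}
    (hq : ∀ i, ∀ p ∈ Q i, p.Coprime q)
    {K : ι → ℕ} {l : ℕ} (hl : l ∈ blockProducts Q K) : l.Coprime q := by
  obtain ⟨f, hf, rfl⟩ := mem_blockProducts.1 hl
  exact Nat.Coprime.prod_left fun i _ =>
    Nat.Coprime.prod_left fun p hpm => hq i p ((hf i).1 hpm)

theorem prod_block_le {ι : Type*} [Fintype ι] {f : ι → Finset ℕ} {U : ι → ℝ} (hU : ∀ i, ∀ p ∈ f i, (p : ℝ) ≤ U i) :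
    ((∏ i, ∏ p ∈ f i, p : ℕ) : ℝ) ≤ ∏ i, U i ^ (f i).card := by
  push_cast
  refine Finset.prod_le_prod (fun i _ => Finset.prod_nonneg fun p _ => Nat.cast_nonneg p)
    fun i _ => ?_
  rw [← Finset.prod_const]
  exact Finset.prod_le_prod (fun p _ => Nat.cast_nonneg p) fun p hp => hU i p hp

theorem le_of_mem_blockProducts {Q : ι → Finset ℕ} {U : ι → ℝ}
    (hU : ∀ i, ∀ p ∈ Q i, (p : ℝ) ≤ U i)
    {K : ι → ℕ} {l : ℕ} (hl : l ∈ blockProducts Q K) : (l : ℝ) ≤ ∏ i, U i ^ K i := by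
  obtain ⟨f, hf, rfl⟩ := mem_blockProducts.1 hl
  refine (prod_block_le fun i p hpm => hU i p ((hf i).1 hpm)).trans_eq ?_
  exact Finset.prod_congr rfl fun i _ => by rw [(hf i).2]

/-- Keep `K i - k i` of the primes of l in each block, that is, form block products over the blocks
of l itself. The cofactor has `k i` primes, each at most `U i`. -/
theorem card_divisors_blockProducts_ge {Q : ι → Finset ℕ} (hp : ∀ i, ∀ p ∈ Q i, p.Prime)
    (hd : Pairwise fun i j => Disjoint (Q i) (Q j)) {U : ι → ℝ}
    (hU : ∀ i, ∀ p ∈ Q i, (p : ℝ) ≤ U i) {K k : ι → ℕ} (hk : ∀ i, k i ≤ K i) {x : ℝ}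
    (hx : ∏ i, U i ^ k i ≤ x) {l : ℕ} (hl : l ∈ blockProducts Q K) :
    ∏ i, (K i).choose (k i) ≤
      ((blockProducts Q fun i => K i - k i).filter fun m => m ∣ l ∧ (l : ℝ) ≤ m * x).card := by
  obtain ⟨g, hg, rfl⟩ := mem_blockProducts.1 hl
  have h1 : (blockProducts g fun i => K i - k i).card = ∏ i, (K i).choose (k i) := by
    rw [card_blockProducts (fun i p hpm => hp i p ((hg i).1 hpm)) (fun i j hij =>
      Finset.disjoint_of_subset_left (hg i).1 (Finset.disjoint_of_subset_right (hg j).1 (hd hij)))]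
    exact Finset.prod_congr rfl fun i _ => by rw [(hg i).2, Nat.choose_symm (hk i)]
  rw [← h1]
  refine Finset.card_le_card fun m hm => ?_
  obtain ⟨f, hf, rfl⟩ := mem_blockProducts.1 hm
  rw [Finset.mem_filter, mem_blockProducts]
  refine ⟨⟨f, fun i => ⟨(hf i).1.trans (hg i).1, (hf i).2⟩, rfl⟩, ?_, ?_⟩
  · exact Finset.prod_dvd_prod_of_dvd _ _ fun i _ => Finset.prod_dvd_prod_of_subset _ _ _ (hf i).1
  · have h2 : ∏ i, ∏ p ∈ g i, p = (∏ i, ∏ p ∈ f i, p) * ∏ i, ∏ p ∈ g i \ f i, p := by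
      rw [← Finset.prod_mul_distrib]
      exact Finset.prod_congr rfl fun i _ => by rw [mul_comm, Finset.prod_sdiff (hf i).1]
    rw [h2, Nat.cast_mul]
    refine mul_le_mul_of_nonneg_left (le_trans ?_ hx) (Nat.cast_nonneg _)
    refine (prod_block_le (U := U) fun i p hpm =>
      hU i p ((hg i).1 (Finset.sdiff_subset hpm))).trans_eq ?_
    refine Finset.prod_congr rfl fun i _ => ?_
    rw [Finset.card_sdiff_of_subset (hf i).1, (hf i).2, (hg i).2, Nat.sub_sub_self (hk i)]

theorem card_le_of_forall_le {A : Finset ℕ} {N : ℝ} (h : ∀ l ∈ A, 0 < l ∧ (l : ℝ) ≤ N)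
    (hN : 0 ≤ N) : (A.card : ℝ) ≤ N := by
  have h1 : A ⊆ Finset.Icc 1 ⌊N⌋₊ := fun l hl =>
    Finset.mem_Icc.2 ⟨(h l hl).1, Nat.le_floor (h l hl).2⟩
  have h2 := Finset.card_le_card h1
  rw [Nat.card_Icc, Nat.add_sub_cancel] at h2
  exact (Nat.cast_le.2 h2).trans (Nat.floor_le hN)

/-- A lower bound for the largest character sum of length `x` in terms of blocks of primes `Q i`
below `U i`: the resonator is made of integers with `K i` or `K i - k i` prime factors in `Q i`. -/
theorem charSum_bound_ge_of_blocks {q : ℕ} [NeZero q] {Q : ι → Finset ℕ}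
    (hp : ∀ i, ∀ p ∈ Q i, p.Prime) (hd : Pairwise fun i j => Disjoint (Q i) (Q j))
    (hq : ∀ i, ∀ p ∈ Q i, p.Coprime q) {U : ι → ℝ} (hU0 : ∀ i, 1 ≤ U i)
    (hU : ∀ i, ∀ p ∈ Q i, (p : ℝ) ≤ U i) {K k : ι → ℕ} (hk : ∀ i, k i ≤ K i)
    (hK : ∀ i, 2 * K i ≤ (Q i).card)
    (hM : ∀ i, 2 * (k i : ℝ) ^ 2 * (Real.exp 2 * U i) ≤ (Q i).card * K i)
    {x Y : ℝ} (hx : ∏ i, U i ^ k i ≤ x) (hNq : ∏ i, U i ^ K i < q)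
    (hNx : (∏ i, U i ^ K i) * x ≤ q.totient) (hY : 0 ≤ Y)
    (hS : ∀ χ : DirichletCharacter ℂ q, χ ≠ 1 → ‖charSum χ x‖ ≤ Y) :
    Real.exp (∑ i, (k i : ℝ)) * √(∏ i, U i ^ k i) - 1 ≤ Y := by
  set N : ℝ := ∏ i, U i ^ K i with hN
  set A := blockProducts Q fun i => K i - k i with hAdef
  set B := blockProducts Q K with hBdef
  have hUpos : ∀ i, 0 < U i := fun i => one_pos.trans_le (hU0 i)
  have hN0 : 0 < N := Finset.prod_pos fun i _ => pow_pos (hUpos i) _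
  have hx0 : 0 < x := lt_of_lt_of_le (Finset.prod_pos fun i _ => pow_pos (hUpos i) _) hx
  have hAN : ∀ l ∈ A, 0 < l ∧ (l : ℝ) ≤ N := fun l hl =>
    ⟨pos_of_mem_blockProducts hp hl, (le_of_mem_blockProducts hU hl).trans <|
      Finset.prod_le_prod (fun i _ => (pow_pos (hUpos i) _).le) fun i _ =>
        pow_le_pow_right₀ (hU0 i) (Nat.sub_le _ _)⟩
  have hBN : ∀ l ∈ B, 0 < l ∧ (l : ℝ) ≤ N := fun l hl =>
    ⟨pos_of_mem_blockProducts hp hl, le_of_mem_blockProducts hU hl⟩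
  have hA : ∀ l ∈ A, l < q ∧ l.Coprime q := fun l hl =>
    ⟨by exact_mod_cast (hAN l hl).2.trans_lt hNq, coprime_of_mem_blockProducts hq hl⟩
  have hB : ∀ l ∈ B, l < q ∧ l.Coprime q := fun l hl =>
    ⟨by exact_mod_cast (hBN l hl).2.trans_lt hNq, coprime_of_mem_blockProducts hq hl⟩
  have hcA : A.card = ∏ i, (Q i).card.choose (K i - k i) := card_blockProducts hp hd _
  have hcB : B.card = ∏ i, (Q i).card.choose (K i) := card_blockProducts hp hd _
  have ha : (0 : ℝ) < A.card := by
    rw [hcA]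
    exact_mod_cast Finset.prod_pos fun i _ => Nat.choose_pos (by have := hK i; omega)
  have hb : (0 : ℝ) < B.card := by
    rw [hcB]
    exact_mod_cast Finset.prod_pos fun i _ => Nat.choose_pos (by have := hK i; omega)
  set h := ∏ i, (K i).choose (k i) with hh
  have hres := resonance_inequality hA hB (fun l hl => (hBN l hl).1.ne') hx0.le hY hS
    (fun l hl => card_divisors_blockProducts_ge hp hd hU hk hx hl)
  rw [← hh] at hres
  have hφ : (0 : ℝ) < q.totient := by
    exact_mod_cast Nat.totient_pos.2 (Nat.pos_of_ne_zero (NeZero.ne q))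
  -- The factor `Real.exp 2` in `hM` becomes e^{2∑k} here, hence e^{∑k} after the square root.
  have hcount : (A.card : ℝ) * (Real.exp (∑ i, (k i : ℝ)) ^ 2 * ∏ i, U i ^ k i)
      ≤ B.card * (h : ℝ) ^ 2 := by
    have e : Real.exp (∑ i, (k i : ℝ)) ^ 2 = ∏ i, Real.exp 2 ^ k i := by
      rw [← Real.exp_nat_mul, Finset.mul_sum, Real.exp_sum]
      exact Finset.prod_congr rfl fun i _ => by rw [← Real.exp_nat_mul]; congr 1; push_cast; ring
    rw [e, hcA, hcB, hh]
    push_cast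
    rw [← Finset.prod_mul_distrib, ← Finset.prod_mul_distrib, ← Finset.prod_pow,
      ← Finset.prod_mul_distrib]
    refine Finset.prod_le_prod (fun i _ => ?_) fun i _ => ?_
    · have := hUpos i
      positivity
    · rw [← mul_pow]
      exact choose_mul_choose_sq_ge (hK i) (hk i) (by have := hUpos i; positivity) (hM i)
  clear_value N A B h
  set s := √((A.card : ℝ) * B.card) with hs
  have hs0 : 0 < s := Real.sqrt_pos.2 (by positivity)
  have hs2 : s ^ 2 = A.card * B.card := Real.sq_sqrt (by positivity)
  clear_value s
  have hsN : s ≤ N := by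
    refine (pow_le_pow_iff_left₀ hs0.le hN0.le two_ne_zero).1 ?_
    rw [hs2, sq]
    exact mul_le_mul (card_le_of_forall_le hAN hN0.le) (card_le_of_forall_le hBN hN0.le)
      hb.le hN0.le
  -- The principal character contributes |A||B|x = s²x ≤ s·φ(q), which costs only the extra 1.
  have h1 : (B.card : ℝ) * h ≤ (Y + 1) * s := by
    have : (q.totient : ℝ) * (B.card * h) ≤ q.totient * ((Y + 1) * s) :=
      calc _ ≤ Y * (q.totient * s) + A.card * B.card * x := hres
        _ = Y * (q.totient * s) + s * (s * x) := by rw [← hs2]; ring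
        _ ≤ Y * (q.totient * s) + s * (N * x) := by gcongr
        _ ≤ Y * (q.totient * s) + s * q.totient := by gcongr
        _ = _ := by ring
    exact le_of_mul_le_mul_left this hφ
  have h2 : (Real.exp (∑ i, (k i : ℝ)) * √(∏ i, U i ^ k i)) * s ≤ B.card * h := by
    refine (pow_le_pow_iff_left₀ (by positivity) (by positivity) two_ne_zero).1 ?_
    rw [mul_pow, mul_pow, Real.sq_sqrt (Finset.prod_nonneg fun i _ => (pow_pos (hUpos i) _).le), hs2]
    calc _ = (A.card : ℝ) * (Real.exp (∑ i, (k i : ℝ)) ^ 2 * ∏ i, U i ^ k i) * B.card := by ring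
      _ ≤ (B.card : ℝ) * (h : ℝ) ^ 2 * B.card := by gcongr
      _ = _ := by ring
  have h3 := le_of_mul_le_mul_right (h2.trans h1) hs0
  linarith

end BlockProducts

/-! ### Primes in the blocks -/

-- Chebyshev's bound ψ(x) ≥ x log 2 - O(log x) with ψ - θ = O(√x); it suffices that log 2 > 1/2.
open Chebyshev in
theorem eventually_half_mul_le_theta : ∀ᶠ x : ℝ in Filter.atTop, x / 2 ≤ θ x := by
  obtain ⟨C, hC⟩ := psi_sub_theta_le_mul_sqrt
  have h1 : (fun x : ℝ => Real.log x) =o[Filter.atTop] fun x : ℝ => x := Real.isLittleO_log_id_atTop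
  have h2 : (fun x : ℝ => √x) =o[Filter.atTop] fun x : ℝ => x := by
    refine Asymptotics.isLittleO_of_tendsto' ?_ ?_
    · filter_upwards [Filter.eventually_gt_atTop 0] with x hx h
      exact absurd h hx.ne'
    · refine (tendsto_inv_atTop_zero.comp Real.tendsto_sqrt_atTop).congr' ?_
      filter_upwards with x
      exact Real.sqrt_div_self'.symm ▸ (one_div _).symm
  have e1 := h1.def (c := 1 / 100) (by norm_num)
  have e2 := (h2.const_mul_left C).def (c := 1 / 100) (by norm_num)
  filter_upwards [e1, e2, Filter.eventually_ge_atTop 100] with x a1 a2 hx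
  rw [Real.norm_eq_abs, Real.norm_eq_abs] at a1 a2
  rw [abs_of_nonneg (by linarith : (0 : ℝ) ≤ x)] at a1 a2
  have b1 := (le_abs_self _).trans a1
  have b2 := (le_abs_self _).trans a2
  have hp := psi_ge' (x := x) (by linarith)
  have hl : Real.log (x + 2) ≤ Real.log x + 1 := by
    rw [← Real.log_exp 1, ← Real.log_mul (by linarith) (Real.exp_pos _).ne']
    apply Real.log_le_log (by linarith)
    have := Real.add_one_le_exp (1 : ℝ)
    nlinarith
  have := hC x
  have hlog2 := Real.log_two_gt_d9
  nlinarith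

/-- The primes in `(16 ^ i, 16 ^ (i + 1)]` not dividing `q`. -/
def primeBlock (q i : ℕ) : Finset ℕ :=
  (Finset.Ioc (16 ^ i) (16 ^ (i + 1))).filter fun p => p.Prime ∧ ¬ p ∣ q

theorem mem_primeBlock {q i p : ℕ} :
    p ∈ primeBlock q i ↔ (16 ^ i < p ∧ p ≤ 16 ^ (i + 1)) ∧ p.Prime ∧ ¬ p ∣ q := by
  simp [primeBlock]

theorem disjoint_primeBlock (q : ℕ) {i j : ℕ} (hij : i ≠ j) :
    Disjoint (primeBlock q i) (primeBlock q j) := by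
  rw [Finset.disjoint_left]
  intro p h1 h2
  rw [mem_primeBlock] at h1 h2
  have a1 := (Nat.pow_lt_pow_iff_right (by norm_num : 1 < 16)).1 (h1.1.1.trans_le h2.1.2)
  have a2 := (Nat.pow_lt_pow_iff_right (by norm_num : 1 < 16)).1 (h2.1.1.trans_le h1.1.2)
  omega

theorem card_primeFactors_le (q : ℕ) (hq : q ≠ 0) : (q.primeFactors.card : ℝ) ≤ 2 * Real.log q := by
  have h1 : 2 ^ q.primeFactors.card ≤ q :=
    (Finset.pow_card_le_prod _ _ _ fun p hp => (Nat.prime_of_mem_primeFactors hp).two_le).trans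
      (Nat.le_of_dvd (Nat.pos_of_ne_zero hq) (Nat.prod_primeFactors_dvd q))
  have h2 : (2 : ℝ) ^ q.primeFactors.card ≤ q := by exact_mod_cast h1
  have h3 := Real.log_le_log (by positivity) h2
  rw [Real.log_pow] at h3
  have := Real.log_two_gt_d9
  have h4 : (0 : ℝ) ≤ q.primeFactors.card := by positivity
  nlinarith

theorem log_sixteen_le : Real.log 16 ≤ 3 := by
  rw [show (16 : ℝ) = 2 ^ 4 by norm_num, Real.log_pow]
  have := Real.log_two_lt_d9
  push_cast
  linarith

theorem two_le_log_sixteen : 2 ≤ Real.log 16 := by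
  rw [show (16 : ℝ) = 2 ^ 4 by norm_num, Real.log_pow]
  have := Real.log_two_gt_d9
  push_cast
  linarith

-- θ(16^(i+1)) ≥ 8·16^i while θ(16^i) ≤ 2·16^i, so the ratio 16 leaves many primes in the block. At
-- most 2 log q of them divide q, and the hypothesis on log q makes this at most half of the bound.
open Chebyshev in
theorem exists_primeBlock_card_ge : ∃ i₀ : ℕ, ∀ i ≥ i₀, ∀ q : ℕ, q ≠ 0 →
    12 * (i + 1) * Real.log q ≤ (16 : ℝ) ^ i →
    (16 : ℝ) ^ i ≤ 6 * (i + 1) * (primeBlock q i).card := by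
  have ht : Filter.Tendsto (fun i : ℕ => (16 : ℝ) ^ (i + 1)) Filter.atTop Filter.atTop :=
    (tendsto_pow_atTop_atTop_of_one_lt (by norm_num)).comp (Filter.tendsto_add_atTop_nat 1)
  obtain ⟨i₀, hi₀⟩ := Filter.eventually_atTop.1 (ht.eventually eventually_half_mul_le_theta)
  refine ⟨i₀, fun i hi q hq hlog => ?_⟩
  have h1 := hi₀ i hi
  have h2 := theta_le_log4_mul_x (x := (16 : ℝ) ^ i) (by positivity)
  have hlog4 : Real.log 4 ≤ 2 := by
    rw [show (4 : ℝ) = 2 ^ 2 by norm_num, Real.log_pow]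
    have := Real.log_two_lt_d9
    push_cast
    linarith
  set P := (Finset.Ioc (16 ^ i) (16 ^ (i + 1))).filter Nat.Prime with hP
  have h3 : θ ((16 : ℝ) ^ (i + 1)) ≤ θ ((16 : ℝ) ^ i) + P.card * ((i + 1) * Real.log 16) := by
    have f : ∀ j : ℕ, ⌊(16 : ℝ) ^ j⌋₊ = 16 ^ j := fun j => by
      rw [show (16 : ℝ) ^ j = ((16 ^ j : ℕ) : ℝ) by push_cast; rfl, Nat.floor_natCast]
    unfold theta
    rw [f, f, ← Finset.Ioc_union_Ioc_eq_Ioc (a := 0) (b := 16 ^ i) (c := 16 ^ (i + 1))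
      (Nat.zero_le _) (Nat.pow_le_pow_right (by norm_num) (by omega)), Finset.filter_union,
      Finset.sum_union]
    · gcongr
      rw [← nsmul_eq_mul]
      refine Finset.sum_le_card_nsmul _ _ _ fun p hp => ?_
      simp only [Finset.mem_filter, Finset.mem_Ioc] at hp
      calc Real.log p ≤ Real.log ((16 : ℝ) ^ (i + 1)) :=
            Real.log_le_log (by exact_mod_cast hp.2.pos) (by exact_mod_cast hp.1.2)
        _ = _ := by rw [Real.log_pow]; push_cast; ring
    · refine Finset.disjoint_filter_filter ?_
      exact Finset.Ioc_disjoint_Ioc_of_le le_rfl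
  have h4 : P.card ≤ (primeBlock q i).card + q.primeFactors.card := by
    refine (Finset.card_le_card ?_).trans (Finset.card_union_le _ _)
    intro p hp
    rw [hP, Finset.mem_filter, Finset.mem_Ioc] at hp
    rw [Finset.mem_union, mem_primeBlock, Nat.mem_primeFactors]
    tauto
  have h5 : (P.card : ℝ) ≤ (primeBlock q i).card + 2 * Real.log q :=
    (by exact_mod_cast h4 : (P.card : ℝ) ≤ (primeBlock q i).card + q.primeFactors.card).trans
      (add_le_add_right (card_primeFactors_le q hq) _)
  have h6 : (16 : ℝ) ^ i ≤ P.card * (3 * (i + 1)) := by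
    have : (P.card : ℝ) * ((i + 1) * Real.log 16) ≤ P.card * ((i + 1) * 3) := by
      gcongr
      exact log_sixteen_le
    have hpos : (0 : ℝ) < 16 ^ i := by positivity
    rw [pow_succ] at h1
    rw [pow_succ] at h3
    nlinarith
  have h7 : (P.card : ℝ) * (3 * (i + 1)) ≤ ((primeBlock q i).card + 2 * Real.log q) * (3 * (i + 1)) := by
    gcongr
  nlinarith

/-! ### Totient bound and elementary sums -/

/-- Multiplicative induction: (p-1)² ≥ p for odd p, and a factor 2 is lost only at the prime 2.
Stating the constant by parity lets it multiply, as coprime factors are not both even. -/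
theorem le_mul_totient_sq {q : ℕ} (hq : 0 < q) :
    q ≤ (if Even q then 2 else 1) * q.totient ^ 2 := by
  induction q using Nat.recOnPosPrimePosCoprime with
  | prime_pow p n hp hn =>
    obtain ⟨n, rfl⟩ : ∃ m, n = m + 1 := ⟨n - 1, by omega⟩
    rw [Nat.totient_prime_pow_succ hp]
    rcases hp.eq_two_or_odd' with rfl | hodd
    · rw [if_pos (by simp [Nat.even_pow])]
      have : 1 ≤ 2 ^ n := Nat.one_le_two_pow
      rw [pow_succ]
      nlinarith
    · have : ¬ Even (p ^ (n + 1)) := by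
        rw [Nat.not_even_iff_odd]
        exact hodd.pow
      rw [if_neg this, one_mul, mul_pow, pow_succ]
      have h3 : 3 ≤ p := by
        have := hp.two_le
        rcases hodd with ⟨k, rfl⟩
        omega
      obtain ⟨r, rfl⟩ : ∃ r, p = r + 3 := ⟨p - 3, by omega⟩
      have h1 : 1 ≤ (r + 3) ^ n := Nat.one_le_pow _ _ (by omega)
      rw [show r + 3 - 1 = r + 2 by omega]
      have h2 : (r + 3) ^ n ≤ ((r + 3) ^ n) ^ 2 := by nlinarith
      exact Nat.mul_le_mul h2 (by nlinarith)
  | zero => omega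
  | one => simp
  | coprime a b ha hb hab iha ihb =>
    have iha := iha (by omega)
    have ihb := ihb (by omega)
    rw [Nat.totient_mul hab]
    have hnot : ¬ (Even a ∧ Even b) := by
      rintro ⟨h1, h2⟩
      have := Nat.dvd_gcd h1.two_dvd h2.two_dvd
      rw [hab] at this
      omega
    have e : (if Even (a * b) then 2 else 1) = (if Even a then 2 else 1) * (if Even b then 2 else 1) := by
      by_cases h1 : Even a <;> by_cases h2 : Even b <;> simp [Nat.even_mul, h1, h2] at hnot ⊢
    rw [e]
    calc a * b ≤ _ := Nat.mul_le_mul iha ihb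
      _ = _ := by ring

theorem le_two_mul_totient_sq {q : ℕ} (hq : 0 < q) : q ≤ 2 * q.totient ^ 2 := by
  refine (le_mul_totient_sq hq).trans ?_
  gcongr
  split_ifs <;> norm_num

/-- This and the next three bounds are telescoping comparisons with 1/i and log i. They control the
size of the resonator, ∑k_i, and log x in terms of a, I, J. -/
theorem sum_Ico_inv_sq_le {I J : ℕ} (hI : 1 ≤ I) (hJ : I ≤ J) :
    ∑ i ∈ Finset.Ico I J, 1 / (i : ℝ) ^ 2 ≤ 2 / (I : ℝ) := by
  suffices h : ∑ i ∈ Finset.Ico I J, 1 / (i : ℝ) ^ 2 ≤ 2 / (I : ℝ) - 2 / (J : ℝ) by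
    have : (0 : ℝ) ≤ 2 / (J : ℝ) := by positivity
    linarith
  induction J, hJ using Nat.le_induction with
  | base => simp
  | succ n hn ih =>
    rw [Finset.sum_Ico_succ_top hn]
    have h0 : (1 : ℝ) ≤ n := by exact_mod_cast hI.trans hn
    have : 1 / (n : ℝ) ^ 2 ≤ 2 / n - 2 / ((n + 1 : ℕ) : ℝ) := by
      push_cast
      rw [div_sub_div _ _ (by positivity) (by positivity), div_le_div_iff₀ (by positivity) (by positivity)]
      nlinarith [mul_nonneg (by linarith : (0 : ℝ) ≤ n) (by linarith : (0 : ℝ) ≤ n - 1)]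
    linarith

theorem le_sum_Ico_inv_sq {I J : ℕ} (hI : 1 ≤ I) (hJ : I ≤ J) :
    1 / (I : ℝ) - 1 / J ≤ ∑ i ∈ Finset.Ico I J, 1 / (i : ℝ) ^ 2 := by
  induction J, hJ using Nat.le_induction with
  | base => simp
  | succ n hn ih =>
    rw [Finset.sum_Ico_succ_top hn]
    have h0 : (1 : ℝ) ≤ n := by exact_mod_cast hI.trans hn
    have : 1 / (n : ℝ) - 1 / ((n + 1 : ℕ) : ℝ) ≤ 1 / (n : ℝ) ^ 2 := by
      push_cast
      rw [div_sub_div _ _ (by positivity) (by positivity), div_le_div_iff₀ (by positivity) (by positivity)]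
      nlinarith
    linarith

theorem log_sub_log_le_sum_Ico {I J : ℕ} (hI : 1 ≤ I) (hJ : I ≤ J) :
    Real.log J - Real.log I ≤ ∑ i ∈ Finset.Ico I J, ((i : ℝ) + 1) / (i : ℝ) ^ 2 := by
  induction J, hJ using Nat.le_induction with
  | base => simp
  | succ n hn ih =>
    rw [Finset.sum_Ico_succ_top hn]
    have h0 : (1 : ℝ) ≤ n := by exact_mod_cast hI.trans hn
    have h1 : Real.log (n + 1) - Real.log n ≤ ((n : ℝ) + 1) / (n : ℝ) ^ 2 := by
      rw [← Real.log_div (by positivity) (by positivity)]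
      refine (Real.log_le_sub_one_of_pos (by positivity)).trans ?_
      rw [div_sub_one (by positivity), div_le_div_iff₀ (by positivity) (by positivity)]
      nlinarith
    push_cast
    linarith

theorem sum_Ico_le_log_sub_log {I J : ℕ} (hI : 1 ≤ I) (hJ : I ≤ J) :
    ∑ i ∈ Finset.Ico I J, ((i : ℝ) + 1) / (i : ℝ) ^ 2 ≤ 4 * (Real.log J - Real.log I) := by
  induction J, hJ using Nat.le_induction with
  | base => simp
  | succ n hn ih =>
    rw [Finset.sum_Ico_succ_top hn]
    have h0 : (1 : ℝ) ≤ n := by exact_mod_cast hI.trans hn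
    have h1 : ((n : ℝ) + 1) / (n : ℝ) ^ 2 ≤ 4 * (Real.log (n + 1) - Real.log n) := by
      rw [← Real.log_div (by positivity) (by positivity)]
      have h2 := Real.one_sub_inv_le_log_of_pos (x := ((n : ℝ) + 1) / n) (by positivity)
      have h3 : ((n : ℝ) + 1) / (n : ℝ) ^ 2 ≤ 4 * (1 - (((n : ℝ) + 1) / n)⁻¹) := by
        rw [inv_div, one_sub_div (by positivity), add_sub_cancel_left, mul_one_div,
          div_le_div_iff₀ (by positivity) (by positivity)]
        nlinarith
      linarith
    push_cast
    linarith

theorem exp_quarter_log_le_totient {q : ℕ} (hq : 4 ≤ q) :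
    Real.exp (Real.log q / 4) ≤ q.totient := by
  have hq0 : (0 : ℝ) < q := by positivity
  have h1 : (q : ℝ) ≤ 2 * (q.totient : ℝ) ^ 2 := by
    exact_mod_cast le_two_mul_totient_sq (by omega : 0 < q)
  have h2 : Real.exp (Real.log q / 4) ^ 4 = q := by
    rw [← Real.exp_nat_mul, show ((4 : ℕ) : ℝ) * (Real.log q / 4) = Real.log q by push_cast; ring,
      Real.exp_log hq0]
  set e := Real.exp (Real.log q / 4) with he
  have he0 : 0 < e := Real.exp_pos _
  have hq4 : (4 : ℝ) ≤ q := by exact_mod_cast hq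
  have h3 : 2 ≤ e ^ 2 := by
    by_contra! h
    nlinarith [pow_pos he0 2]
  refine (pow_le_pow_iff_left₀ he0.le (Nat.cast_nonneg _) two_ne_zero).1 ?_
  nlinarith [pow_pos he0 2]

/-! ### The bound for block parameters I, J, a -/

set_option maxHeartbeats 1000000 in
/-- The lower bound given by the blocks of primes in `(16 ^ i, 16 ^ (i + 1)]` for `I ≤ i < J`, with
about `a / i ^ 2` prime factors taken from the `i`-th block. -/
theorem charSum_bound_ge_of_parameters {q : ℕ} [NeZero q] {I J : ℕ} {a x Y : ℝ}
    (hI : 2 ≤ I) (hJ : 3 * I ≤ J)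
    (hblock : ∀ i : ℕ, I ≤ i → (16 : ℝ) ^ i ≤ 6 * (i + 1) * (primeBlock q i).card)
    (ha : 276480 * a ^ 2 ≤ I * Real.log q)
    (hq16 : ∀ i : ℕ, I ≤ i → 17280 * Real.log q ≤ (16 : ℝ) ^ i) (hx0 : 0 < x)
    (hax : a * (Real.log 16 * ∑ i ∈ Finset.Ico I J, ((i : ℝ) + 1) / (i : ℝ) ^ 2) = Real.log x)
    (haJ : 12 * (J : ℝ) ^ 2 * I ≤ a) (hxq : Real.log x ≤ Real.log q / 8) (hq4 : 4 ≤ q)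
    (hY : 0 ≤ Y) (hS : ∀ χ : DirichletCharacter ℂ q, χ ≠ 1 → ‖charSum χ x‖ ≤ Y) :
    √x * Real.exp (a / (4 * I)) / 2 ≤ Y := by
  classical
  have hIJ : I ≤ J := by omega
  have hI0 : (2 : ℝ) ≤ I := by exact_mod_cast hI
  have hJ0 : (3 : ℝ) * I ≤ J := by exact_mod_cast hJ
  have hJ1 : (1 : ℝ) ≤ J := by linarith
  have ha0 : 0 ≤ a := le_trans (by positivity) haJ
  have hl16 := log_sixteen_le
  have hl16' := two_le_log_sixteen
  have hLq : 0 < Real.log q := Real.log_pos (by exact_mod_cast (by omega : 1 < q))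
  set k : ℕ → ℕ := fun i => ⌊a / (i : ℝ) ^ 2⌋₊ with hk
  -- The block has at least 16^i/(6(i+1)) primes and 2e²·16 ≤ 240, so 1440 = 240·6 is what the
  -- hypothesis `hM` of `charSum_bound_ge_of_blocks` requires.
  set K : ℕ → ℕ := fun i => 1440 * k i ^ 2 * (i + 1) with hK
  have hkle : ∀ i : ℕ, (k i : ℝ) ≤ a / (i : ℝ) ^ 2 := fun i => Nat.floor_le (by positivity)
  have hkge : ∀ i : ℕ, a / (i : ℝ) ^ 2 - 1 ≤ (k i : ℝ) := fun i : ℕ =>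
    (sub_lt_iff_lt_add.2 (Nat.lt_floor_add_one _)).le
  have hpt : ∀ i : ℕ, I ≤ i → ((k i : ℝ) * (i + 1)) ^ 2 ≤ 4 * a ^ 2 * (1 / (i : ℝ) ^ 2) := by
    intro i hi
    have hi0 : (1 : ℝ) ≤ i := by exact_mod_cast (by omega : 1 ≤ i)
    have h1 : (k i : ℝ) * (i + 1) ≤ 2 * a / i :=
      calc (k i : ℝ) * (i + 1) ≤ a / (i : ℝ) ^ 2 * (2 * i) := by
            gcongr
            · exact hkle i
            · linarith
        _ = 2 * a / i := by field_simp
    calc ((k i : ℝ) * (i + 1)) ^ 2 ≤ (2 * a / i) ^ 2 := by gcongr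
      _ = _ := by ring
  have ha2 : a ^ 2 / I ≤ Real.log q / 276480 := by
    rw [div_le_div_iff₀ (by positivity) (by positivity)]
    linarith
  have hptq : ∀ i : ℕ, I ≤ i → ((k i : ℝ) * (i + 1)) ^ 2 ≤ Real.log q := by
    intro i hi
    have hi0 : (I : ℝ) ≤ i := by exact_mod_cast hi
    have h1 : 1 / (i : ℝ) ^ 2 ≤ 1 / I := by
      apply one_div_le_one_div_of_le (by positivity)
      nlinarith
    calc _ ≤ 4 * a ^ 2 * (1 / (i : ℝ) ^ 2) := hpt i hi
      _ ≤ 4 * a ^ 2 * (1 / I) := by gcongr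
      _ = 4 * (a ^ 2 / I) := by ring
      _ ≤ Real.log q := by linarith
  have hexp2 : Real.exp 2 ≤ 7.5 := by
    have := Real.exp_one_lt_d9
    have h0 := Real.exp_pos 1
    rw [show (2 : ℝ) = 1 + 1 by norm_num, Real.exp_add]
    nlinarith
  have hprod : ∀ f : ℕ → ℕ, ∏ i : Finset.Ico I J, ((16 : ℝ) ^ ((i : ℕ) + 1)) ^ f i =
      Real.exp (Real.log 16 * ∑ i ∈ Finset.Ico I J, (f i : ℝ) * (i + 1)) := by
    intro f
    rw [Finset.prod_coe_sort (Finset.Ico I J) fun i => ((16 : ℝ) ^ (i + 1)) ^ f i, Finset.mul_sum,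
      Real.exp_sum]
    refine Finset.prod_congr rfl fun i _ => ?_
    rw [← pow_mul, mul_comm (Real.log 16), mul_comm (i + 1)]
    rw [show (f i : ℝ) * (i + 1) = ((f i * (i + 1) : ℕ) : ℝ) by push_cast; ring, Real.exp_nat_mul,
      Real.exp_log (by norm_num)]
  -- Here 276480 = 8·3·11520, with log 16 ≤ 3. Elements of `B` are at most q^(1/8), leaving q^(1/8)
  -- for x below φ(q) ≥ q^(1/4).
  have hN : ∏ i : Finset.Ico I J, ((16 : ℝ) ^ ((i : ℕ) + 1)) ^ K i ≤ Real.exp (Real.log q / 8) := by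
    rw [hprod]
    apply Real.exp_le_exp.2
    have h1 : ∑ i ∈ Finset.Ico I J, (K i : ℝ) * (i + 1) ≤ 1440 * (4 * a ^ 2 * (2 / I)) :=
      calc ∑ i ∈ Finset.Ico I J, (K i : ℝ) * (i + 1)
          = ∑ i ∈ Finset.Ico I J, 1440 * ((k i : ℝ) * (i + 1)) ^ 2 := by
            refine Finset.sum_congr rfl fun i _ => ?_
            simp only [hK]
            push_cast
            ring
        _ ≤ ∑ i ∈ Finset.Ico I J, 1440 * (4 * a ^ 2 * (1 / (i : ℝ) ^ 2)) := by
            refine Finset.sum_le_sum fun i hi => ?_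
            have := hpt i (Finset.mem_Ico.1 hi).1
            linarith
        _ = 1440 * (4 * a ^ 2 * ∑ i ∈ Finset.Ico I J, 1 / (i : ℝ) ^ 2) := by
            rw [← Finset.mul_sum, ← Finset.mul_sum]
        _ ≤ _ := by
            gcongr
            exact sum_Ico_inv_sq_le (by omega) hIJ
    have h2 : (0 : ℝ) ≤ ∑ i ∈ Finset.Ico I J, (K i : ℝ) * (i + 1) :=
      Finset.sum_nonneg fun i _ => by positivity
    have h3 : 1440 * (4 * a ^ 2 * (2 / I)) = 11520 * (a ^ 2 / I) := by ring
    nlinarith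
  have hsumk : Real.log 16 * ∑ i ∈ Finset.Ico I J, (k i : ℝ) * (i + 1) ≤ Real.log x := by
    rw [← hax, mul_left_comm]
    refine mul_le_mul_of_nonneg_left ?_ (by linarith)
    rw [Finset.mul_sum]
    refine Finset.sum_le_sum fun i _ => ?_
    calc (k i : ℝ) * (i + 1) ≤ a / (i : ℝ) ^ 2 * (i + 1) := by
          gcongr
          exact hkle i
      _ = _ := by ring
  have hcard : ((Finset.Ico I J).card : ℝ) ≤ J := by
    rw [Nat.card_Ico]
    exact_mod_cast Nat.sub_le _ _
  -- Rounding `k` down loses less than i + 1 ≤ J in each of at most J terms.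
  have hsumk' : Real.log x - 3 * (J : ℝ) ^ 2 ≤
      Real.log 16 * ∑ i ∈ Finset.Ico I J, (k i : ℝ) * (i + 1) := by
    have h1 : a * ∑ i ∈ Finset.Ico I J, ((i : ℝ) + 1) / (i : ℝ) ^ 2 ≤
        ∑ i ∈ Finset.Ico I J, (k i : ℝ) * (i + 1) + (J : ℝ) ^ 2 :=
      calc _ = ∑ i ∈ Finset.Ico I J, a / (i : ℝ) ^ 2 * (i + 1) := by
            rw [Finset.mul_sum]
            exact Finset.sum_congr rfl fun i _ => by ring
        _ ≤ ∑ i ∈ Finset.Ico I J, ((k i : ℝ) * (i + 1) + J) := by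
            refine Finset.sum_le_sum fun i hi => ?_
            have h2 : (i : ℝ) + 1 ≤ J := by exact_mod_cast (Finset.mem_Ico.1 hi).2
            have h3 := hkge i
            have h4 : (0 : ℝ) ≤ (i : ℝ) + 1 := by positivity
            nlinarith
        _ = ∑ i ∈ Finset.Ico I J, (k i : ℝ) * (i + 1) + (Finset.Ico I J).card * J := by
            rw [Finset.sum_add_distrib, Finset.sum_const, nsmul_eq_mul]
        _ ≤ _ := by
            rw [sq]
            gcongr
    rw [← hax]
    nlinarith [sq_nonneg (J : ℝ)]
  have hcount : a / (2 * I) - J ≤ ∑ i ∈ Finset.Ico I J, (k i : ℝ) := by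
    have h1 : 1 / (2 * (I : ℝ)) ≤ 1 / (I : ℝ) - 1 / J := by
      have : 1 / (J : ℝ) ≤ 1 / (2 * (I : ℝ)) := one_div_le_one_div_of_le (by positivity) (by linarith)
      have h2 : 1 / (I : ℝ) = 1 / (2 * (I : ℝ)) + 1 / (2 * (I : ℝ)) := by field_simp; norm_num
      linarith
    calc a / (2 * I) - J ≤ a * (1 / (I : ℝ) - 1 / J) - (Finset.Ico I J).card := by
          have := mul_le_mul_of_nonneg_left h1 ha0
          rw [mul_one_div] at this
          linarith
      _ ≤ a * ∑ i ∈ Finset.Ico I J, 1 / (i : ℝ) ^ 2 - (Finset.Ico I J).card := by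
          gcongr
          exact le_sum_Ico_inv_sq (by omega) hIJ
      _ = ∑ i ∈ Finset.Ico I J, (a / (i : ℝ) ^ 2 - 1) := by
          rw [Finset.sum_sub_distrib, Finset.mul_sum, Finset.sum_const, nsmul_eq_mul, mul_one]
          congr 1
          exact Finset.sum_congr rfl fun i _ => by ring
      _ ≤ _ := Finset.sum_le_sum fun i _ => hkge i
  have hxe : Real.exp (Real.log x) = x := Real.exp_log hx0
  have hφ := exp_quarter_log_le_totient hq4
  have hmain := charSum_bound_ge_of_blocks (ι := Finset.Ico I J)
    (Q := fun i => primeBlock q i) (U := fun i => (16 : ℝ) ^ ((i : ℕ) + 1))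
    (K := fun i => K i) (k := fun i => k i) (x := x) (Y := Y)
    (fun i p hp => (mem_primeBlock.1 hp).2.1)
    (fun i j hij => disjoint_primeBlock q (Subtype.coe_injective.ne hij))
    (fun i p hp => ((mem_primeBlock.1 hp).2.1.coprime_iff_not_dvd).2 (mem_primeBlock.1 hp).2.2)
    (fun i => one_le_pow₀ (by norm_num))
    (fun i p hp => by exact_mod_cast (mem_primeBlock.1 hp).1.2)
    (fun i => by
      simp only [hK]
      nlinarith [Nat.zero_le (k i ^ 2 * i), sq_nonneg (k i - 1 : ℤ), Nat.le_self_pow two_ne_zero (k i)])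
    (fun i => by
      have hi := (Finset.mem_Ico.1 i.2).1
      have h1 := hptq i hi
      have h2 := hq16 i hi
      have h3 := hblock i hi
      have h4 : ((2 * K i : ℕ) : ℝ) ≤ (primeBlock q i).card := by
        have h5 : (0 : ℝ) < 6 * ((i : ℕ) + 1) := by positivity
        refine le_of_mul_le_mul_left ?_ h5
        simp only [hK]
        push_cast
        nlinarith
      exact_mod_cast h4)
    (fun i => by
      have hi := (Finset.mem_Ico.1 i.2).1
      have h3 := hblock i hi
      have h4 : 2 * (k i : ℝ) ^ 2 * (Real.exp 2 * 16 ^ ((i : ℕ) + 1)) ≤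
          240 * (k i : ℝ) ^ 2 * 16 ^ (i : ℕ) := by
        calc _ = Real.exp 2 * (32 * ((k i : ℝ) ^ 2 * 16 ^ (i : ℕ))) := by ring
          _ ≤ 7.5 * (32 * ((k i : ℝ) ^ 2 * 16 ^ (i : ℕ))) := by gcongr
          _ = _ := by ring
      have h5 : 240 * (k i : ℝ) ^ 2 * 16 ^ (i : ℕ) ≤
          240 * (k i : ℝ) ^ 2 * (6 * ((i : ℕ) + 1) * (primeBlock q i).card) := by gcongr
      refine h4.trans (h5.trans_eq ?_)
      simp only [hK]
      push_cast
      ring)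
    (by
      rw [hprod, ← hxe]
      exact Real.exp_le_exp.2 hsumk)
    (by
      refine hN.trans_lt ?_
      calc Real.exp (Real.log q / 8) < Real.exp (Real.log q) := Real.exp_lt_exp.2 (by linarith)
        _ = q := Real.exp_log (by positivity))
    (by
      refine le_trans ?_ hφ
      calc _ ≤ Real.exp (Real.log q / 8) * Real.exp (Real.log q / 8) := by
            gcongr
            rw [← hxe]
            exact Real.exp_le_exp.2 hxq
        _ = _ := by rw [← Real.exp_add]; congr 1; ring)
    hY hS
  rw [hprod, Finset.sum_coe_sort (Finset.Ico I J) fun i => (k i : ℝ)] at hmain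
  have hsqrt : ∀ y : ℝ, √(Real.exp y) = Real.exp (y / 2) := fun y => by
    rw [Real.exp_half]
  rw [hsqrt, ← Real.exp_add] at hmain
  have hsx : √x = Real.exp (Real.log x / 2) := by rw [← hsqrt, hxe]
  rw [hsx, ← Real.exp_add]
  -- The rounding losses, 3J²/2 in log √x and J in ∑k, fit into half of the gain a/(2I).
  have hg : 3 * (J : ℝ) ^ 2 ≤ a / (4 * I) := by
    rw [le_div_iff₀ (by positivity)]
    linarith
  have hlogx : 0 ≤ Real.log x := by
    rw [← hax]
    have : 0 ≤ ∑ i ∈ Finset.Ico I J, ((i : ℝ) + 1) / (i : ℝ) ^ 2 :=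
      Finset.sum_nonneg fun i _ => by positivity
    have : 0 ≤ Real.log 16 := by linarith
    positivity
  have hJ2 : (J : ℝ) ≤ J ^ 2 := by nlinarith
  have hle : Real.log x / 2 + a / (4 * I) ≤ ∑ i ∈ Finset.Ico I J, (k i : ℝ) +
      Real.log 16 * (∑ i ∈ Finset.Ico I J, (k i : ℝ) * (i + 1)) / 2 := by
    have h2 : a / (2 * I) = a / (4 * I) + a / (4 * I) := by ring
    linarith
  have hE := (Real.exp_le_exp.2 hle).trans (sub_le_iff_le_add.1 hmain)
  have h2 : 2 ≤ Real.exp (Real.log x / 2 + a / (4 * I)) := by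
    have := Real.add_one_le_exp (Real.log x / 2 + a / (4 * I))
    linarith
  linarith

/-! ### Choice of parameters for a given length -/

theorem twelve_mul_le_sixteen_pow {y : ℝ} {i : ℕ} (hi : 11 ≤ i) (hy : Real.exp i ≥ y) (hy0 : 0 ≤ y) :
    12 * (i + 1) * y ≤ (16 : ℝ) ^ i := by
  have h1 : (12 : ℝ) ≤ 2 ^ i :=
    calc (12 : ℝ) ≤ 2 ^ 11 := by norm_num
      _ ≤ 2 ^ i := pow_le_pow_right₀ (by norm_num) hi
  have h2 : Real.exp i * Real.exp i ≤ (8 : ℝ) ^ i := by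
    have : Real.exp 1 * Real.exp 1 ≤ 8 := by
      have := Real.exp_one_lt_d9
      have h0 := Real.exp_pos 1
      nlinarith
    calc Real.exp i * Real.exp i = (Real.exp 1 * Real.exp 1) ^ i := by
          rw [mul_pow, ← Real.exp_nat_mul, mul_one]
      _ ≤ 8 ^ i := by gcongr
  have h3 : (i : ℝ) + 1 ≤ Real.exp i := Real.add_one_le_exp _
  calc 12 * ((i : ℝ) + 1) * y = 12 * (((i : ℝ) + 1) * y) := by ring
    _ ≤ 2 ^ i * (Real.exp i * Real.exp i) := by gcongr
    _ ≤ 2 ^ i * 8 ^ i := by gcongr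
    _ = 16 ^ i := by rw [← mul_pow]; norm_num

/-- Since ητ = τ² + 1, the target exponent has order τ(1 + log t)/t² with t = max τ 1, the form
produced by the parameters below. -/
theorem one_add_log_mul_div_le {τ η : ℝ} (hτ : 0 < τ) (hη : η = τ + 1 / τ) :
    (1 + Real.log (η * τ)) / η ≤ 2 * τ * (1 + Real.log (max τ 1)) / (max τ 1) ^ 2 := by
  set t := max τ 1 with ht
  have ht1 : 1 ≤ t := le_max_right _ _
  have htτ : τ ≤ t := le_max_left _ _
  have e1 : η * τ = τ ^ 2 + 1 := by
    rw [hη]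
    field_simp
  have e2 : η = (τ ^ 2 + 1) / τ := by
    rw [← e1]
    field_simp
  have h1 : Real.log (η * τ) ≤ 1 + 2 * Real.log t := by
    rw [e1]
    calc Real.log (τ ^ 2 + 1) ≤ Real.log (2 * t ^ 2) :=
          Real.log_le_log (by positivity) (by nlinarith)
      _ = Real.log 2 + 2 * Real.log t := by
          rw [Real.log_mul (by norm_num) (by positivity), Real.log_pow]
          push_cast
          rfl
      _ ≤ _ := by
          have := Real.log_two_lt_d9
          linarith
  have h2 : t ^ 2 ≤ τ ^ 2 + 1 := by
    rcases max_cases τ 1 with ⟨h, -⟩ | ⟨h, -⟩ <;> rw [ht, h] <;> nlinarith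
  have hlog : 0 ≤ Real.log t := Real.log_nonneg ht1
  calc (1 + Real.log (η * τ)) / η ≤ (2 * (1 + Real.log t)) / η := by
        have : 0 < η := by rw [e2]; positivity
        gcongr
        linarith
    _ = (2 * τ * (1 + Real.log t)) / (τ ^ 2 + 1) := by rw [e2]; field_simp
    _ ≤ _ := by gcongr

set_option maxHeartbeats 1000000 in
/-- The lower bound for one length, under an explicit largeness condition on `log q`. -/
theorem charSum_bound_ge_of_large {q i₀ : ℕ} [NeZero q]
    (hi₀ : ∀ i ≥ i₀, 12 * (i + 1) * Real.log q ≤ (16 : ℝ) ^ i →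
      (16 : ℝ) ^ i ≤ 6 * (i + 1) * (primeBlock q i).card)
    {τ η x T Y : ℝ} (hq4 : 4 ≤ q) (hℓ : 1 ≤ Real.log (Real.log q))
    (hℓi : (i₀ : ℝ) ≤ Real.log (Real.log q)) (hτ : 0 < τ) (hτT : τ ≤ T) (hT1 : 1 ≤ T)
    (hTτ : 1 ≤ τ * T)
    (hbig : 4608 * 70001 ^ 3 * (T ^ 10 * Real.log (Real.log q) ^ 3) ≤ √(Real.log q))
    (hη : η = τ + 1 / τ) (hx0 : 0 < x)
    (hx : Real.log x = τ * √(Real.log q * Real.log (Real.log q)))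
    (hY : 0 ≤ Y) (hS : ∀ χ : DirichletCharacter ℂ q, χ ≠ 1 → ‖charSum χ x‖ ≤ Y) :
    √x * Real.exp (1 / 13440192 * ((1 + Real.log (η * τ)) / η) *
      √(Real.log q / Real.log (Real.log q))) / 2 ≤ Y := by
  set L := Real.log q with hL
  set ℓ := Real.log L with hℓdef
  set t := max τ 1 with ht
  set h := 1 + Real.log t with hh
  have ht1 : 1 ≤ t := le_max_right _ _
  have htτ : τ ≤ t := le_max_left _ _
  have htT : t ≤ T := max_le hτT hT1
  have hL0 : 0 < L := Real.log_pos (by exact_mod_cast (by omega : 1 < q))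
  have hlogt : 0 ≤ Real.log t := Real.log_nonneg ht1
  have hh1 : 1 ≤ h := by linarith
  have hht : h ≤ t := by
    have := Real.log_le_sub_one_of_pos (by linarith : 0 < t)
    linarith
  -- The size condition with a ≤ log x/(2h) gives a² ≤ ρL/4, so I ≥ (276480/4)ρ = 69120ρ suffices;
  -- hence 70000 below.
  set ρ := t ^ 2 * ℓ / h ^ 2 with hρ
  have hρℓ : ℓ ≤ ρ := by
    rw [hρ, le_div_iff₀ (by positivity)]
    have : h ^ 2 ≤ t ^ 2 := by gcongr
    nlinarith
  have hρ1 : 1 ≤ ρ := hℓ.trans hρℓ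
  have hρle : ρ ≤ t ^ 2 * ℓ := by
    rw [hρ]
    exact div_le_self (by positivity) (one_le_pow₀ hh1)
  set I := ⌈70000 * ρ⌉₊ with hI
  have hIge : 70000 * ρ ≤ I := Nat.le_ceil _
  have hIle : (I : ℝ) ≤ 70001 * ρ := by
    have := Nat.ceil_lt_add_one (by positivity : 0 ≤ 70000 * ρ)
    linarith
  -- J = nI makes log(J/I) = log n comparable to h; the 3 ensures J ≥ 3I even when t = 1.
  set n := ⌈3 * t⌉₊ with hn
  have hnge : 3 * t ≤ n := Nat.le_ceil _
  have hnle : (n : ℝ) ≤ 4 * t := by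
    have := Nat.ceil_lt_add_one (by positivity : 0 ≤ 3 * t)
    linarith
  have hI70 : (70000 : ℝ) ≤ I := by linarith
  have hI70' : 70000 ≤ I := by exact_mod_cast hI70
  have hn3 : 3 ≤ n := by
    have : (3 : ℝ) ≤ n := by linarith
    exact_mod_cast this
  have hIJ : I ≤ n * I := Nat.le_mul_of_pos_left _ (by omega)
  have hlogJ : Real.log ((n * I : ℕ) : ℝ) - Real.log I = Real.log n := by
    push_cast
    rw [Real.log_mul (by positivity) (by positivity)]
    ring
  have hlogn1 : h ≤ Real.log n := by
    have h3 : (1 : ℝ) ≤ Real.log 3 := by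
      rw [Real.le_log_iff_exp_le (by norm_num)]
      have := Real.exp_one_lt_d9
      linarith
    calc h ≤ Real.log 3 + Real.log t := by linarith
      _ = Real.log (3 * t) := (Real.log_mul (by norm_num) (by positivity)).symm
      _ ≤ _ := Real.log_le_log (by positivity) hnge
  have hlogn2 : Real.log n ≤ 2 * h := by
    have h4 : Real.log 4 ≤ 2 := by
      rw [show (4 : ℝ) = 2 ^ 2 by norm_num, Real.log_pow]
      have := Real.log_two_lt_d9
      push_cast
      linarith
    calc Real.log n ≤ Real.log (4 * t) := Real.log_le_log (by positivity) hnle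
      _ = Real.log 4 + Real.log t := Real.log_mul (by norm_num) (by positivity)
      _ ≤ _ := by linarith
  set W := ∑ i ∈ Finset.Ico I (n * I), ((i : ℝ) + 1) / (i : ℝ) ^ 2 with hW
  have hW1 : h ≤ W := by
    have := log_sub_log_le_sum_Ico (by omega : 1 ≤ I) hIJ
    rw [hlogJ] at this
    linarith
  have hW2 : W ≤ 8 * h := by
    have := sum_Ico_le_log_sub_log (by omega : 1 ≤ I) hIJ
    rw [hlogJ] at this
    linarith
  have h16a := log_sixteen_le
  have h16b := two_le_log_sixteen
  have hV1 : 2 * h ≤ Real.log 16 * W := by gcongr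
  have hV2 : Real.log 16 * W ≤ 24 * h :=
    calc Real.log 16 * W ≤ 3 * (8 * h) := by gcongr
      _ = _ := by ring
  have hV0 : 0 < Real.log 16 * W := by linarith
  set a := Real.log x / (Real.log 16 * W) with ha
  have hlogx0 : 0 ≤ Real.log x := by rw [hx]; positivity
  have haub : a ≤ Real.log x / (2 * h) := by
    rw [ha]
    gcongr
  have halb : Real.log x / (24 * h) ≤ a := by
    rw [ha]
    gcongr
  have ha0 : 0 ≤ a := by positivity
  set s := √L with hs
  have hs0 : 0 < s := Real.sqrt_pos.2 hL0
  have hs2 : s ^ 2 = L := Real.sq_sqrt hL0.le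
  have hr1 : 1 ≤ √ℓ := Real.one_le_sqrt.2 hℓ
  have hr2 : √ℓ ^ 2 = ℓ := Real.sq_sqrt (by linarith)
  have hrℓ : √ℓ ≤ ℓ := by nlinarith
  have hx' : Real.log x = τ * (s * √ℓ) := by rw [hx, Real.sqrt_mul hL0.le]
  have hT10 : T ≤ T ^ 10 := le_self_pow₀ hT1 (by norm_num)
  have hℓ3 : ℓ ≤ ℓ ^ 3 := le_self_pow₀ hℓ (by norm_num)
  have hexpI : ∀ i : ℕ, I ≤ i → L ≤ Real.exp i := by
    intro i hi
    have hi' : (I : ℝ) ≤ i := by exact_mod_cast hi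
    calc L = Real.exp ℓ := (Real.exp_log hL0).symm
      _ ≤ Real.exp i := Real.exp_le_exp.2 (by linarith)
  have hpow : ∀ i : ℕ, I ≤ i → 12 * (i + 1) * L ≤ (16 : ℝ) ^ i := fun i hi =>
    twelve_mul_le_sixteen_pow (by omega) (hexpI i hi) hL0.le
  have hmain : √x * Real.exp (a / (4 * I)) / 2 ≤ Y := by
    refine charSum_bound_ge_of_parameters (I := I) (J := n * I) (a := a) (by omega)
      (Nat.mul_le_mul_right _ hn3) ?_ ?_ ?_ hx0 ?_ ?_ ?_ hq4 hY hS
    · intro i hi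
      have hi' : (I : ℝ) ≤ i := by exact_mod_cast hi
      refine hi₀ i ?_ (hpow i hi)
      have : (i₀ : ℝ) ≤ i := by linarith
      exact_mod_cast this
    · have h1 : a ^ 2 ≤ ρ * L / 4 :=
        calc a ^ 2 ≤ (Real.log x / (2 * h)) ^ 2 := by gcongr
          _ = τ ^ 2 * ℓ / h ^ 2 * L / 4 := by
            rw [hx', div_pow, mul_pow, mul_pow, mul_pow, hs2, hr2]
            field_simp
            ring
          _ ≤ t ^ 2 * ℓ / h ^ 2 * L / 4 := by gcongr
      have h2 := mul_le_mul_of_nonneg_right hIge hL0.le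
      have h3 : 0 ≤ ρ * L := by positivity
      linarith
    · intro i hi
      have hi' : (I : ℝ) ≤ i := by exact_mod_cast hi
      refine le_trans ?_ (hpow i hi)
      gcongr
      linarith
    · rw [ha, div_mul_cancel₀ _ hV0.ne']
    · refine le_trans ?_ halb
      have h1 : 12 * ((n * I : ℕ) : ℝ) ^ 2 * I ≤ 192 * 70001 ^ 3 * (t ^ 8 * ℓ ^ 3) := by
        push_cast
        calc 12 * ((n : ℝ) * I) ^ 2 * I = 12 * (n : ℝ) ^ 2 * (I : ℝ) ^ 3 := by ring
          _ ≤ 12 * (4 * t) ^ 2 * (70001 * (t ^ 2 * ℓ)) ^ 3 := by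
            gcongr
            exact hIle.trans (by gcongr)
          _ = _ := by ring
      refine h1.trans ?_
      rw [le_div_iff₀ (by positivity)]
      -- The tenth power of T in `hbig`: eight from J²I, one from h ≤ t, one from τ ≥ 1/T.
      have h2 : 4608 * 70001 ^ 3 * (t ^ 8 * ℓ ^ 3) * h * T ≤ s :=
        calc 4608 * 70001 ^ 3 * (t ^ 8 * ℓ ^ 3) * h * T
            ≤ 4608 * 70001 ^ 3 * (T ^ 8 * ℓ ^ 3) * T * T := by
              gcongr
              exact hht.trans htT
          _ = 4608 * 70001 ^ 3 * (T ^ 10 * ℓ ^ 3) := by ring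
          _ ≤ s := hbig
      calc 192 * 70001 ^ 3 * (t ^ 8 * ℓ ^ 3) * (24 * h)
          = 4608 * 70001 ^ 3 * (t ^ 8 * ℓ ^ 3) * h * 1 := by ring
        _ ≤ 4608 * 70001 ^ 3 * (t ^ 8 * ℓ ^ 3) * h * (τ * T) := by gcongr
        _ = τ * (4608 * 70001 ^ 3 * (t ^ 8 * ℓ ^ 3) * h * T) := by ring
        _ ≤ τ * (s * √ℓ) := by
            exact mul_le_mul_of_nonneg_left
              (h2.trans (le_mul_of_one_le_right hs0.le hr1)) hτ.le
        _ = Real.log x := hx'.symm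
    · rw [hx', ← hL, ← hs2]
      have h2 : 8 * (τ * √ℓ) ≤ s :=
        calc 8 * (τ * √ℓ) ≤ 8 * (T ^ 10 * ℓ ^ 3) := by
              have := hτT.trans hT10
              have := hrℓ.trans hℓ3
              gcongr
          _ ≤ 4608 * 70001 ^ 3 * (T ^ 10 * ℓ ^ 3) := by
              gcongr
              norm_num
          _ ≤ s := hbig
      nlinarith
  refine le_trans ?_ hmain
  gcongr
  have hI0 : (0 : ℝ) < I := by linarith
  have hsl : s * √ℓ = √(L / ℓ) * ℓ := by
    rw [Real.sqrt_div hL0.le, div_mul_eq_mul_div, eq_div_iff (by positivity), ← hs, mul_assoc,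
      ← sq, hr2]
  calc 1 / 13440192 * ((1 + Real.log (η * τ)) / η) * √(L / ℓ)
      ≤ 1 / 13440192 * (2 * τ * h / t ^ 2) * √(L / ℓ) := by
        refine mul_le_mul_of_nonneg_right (mul_le_mul_of_nonneg_left ?_ (by norm_num))
          (Real.sqrt_nonneg _)
        exact one_add_log_mul_div_le hτ hη
    _ = Real.log x / (24 * h) / (4 * (70001 * ρ)) := by
        rw [hx', hsl, hρ]
        field_simp
        norm_num
    _ ≤ a / (4 * I) := by gcongr

/-! ### Existence of the maximum -/

theorem sum_range_dirichletCharacter_eq_zero {q : ℕ} [NeZero q] {χ : DirichletCharacter ℂ q}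
    (hχ : χ ≠ 1) : ∑ n ∈ Finset.range q, χ (n : ZMod q) = 0 := by
  rw [← MulChar.sum_eq_zero_of_ne_one hχ]
  refine Finset.sum_bij' (fun n _ => (n : ZMod q)) (fun a _ => a.val) (fun _ _ => Finset.mem_univ _)
    (fun a _ => Finset.mem_range.2 (ZMod.val_lt a)) (fun n hn => ?_) (fun a _ => ?_) fun _ _ => rfl
  · exact ZMod.val_cast_of_lt (Finset.mem_range.1 hn)
  · exact ZMod.natCast_zmod_val a

theorem norm_charSum_le_modulus {q : ℕ} [NeZero q] {χ : DirichletCharacter ℂ q} (hχ : χ ≠ 1)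
    (x : ℝ) : ‖charSum χ x‖ ≤ q := by
  set g : ℕ → ℂ := fun N => ∑ n ∈ Finset.range N, χ ((n + 1 : ℕ) : ZMod q) with hg
  have hper : ∀ N, g (N + q) = g N := by
    intro N
    induction N with
    | zero =>
      have h1 := Finset.sum_range_succ (fun n : ℕ => χ (n : ZMod q)) q
      rw [Finset.sum_range_succ', sum_range_dirichletCharacter_eq_zero hχ, ZMod.natCast_self,
        Nat.cast_zero, zero_add] at h1
      rw [Nat.zero_add]
      simpa [hg] using h1
    | succ N ih =>
      have h1 : g (N + 1 + q) = g (N + q) + χ ((N + q + 1 : ℕ) : ZMod q) := by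
        rw [show N + 1 + q = N + q + 1 by ring]
        exact Finset.sum_range_succ _ _
      have h2 : g (N + 1) = g N + χ ((N + 1 : ℕ) : ZMod q) := Finset.sum_range_succ _ _
      rw [h1, h2, ih]
      push_cast
      rw [ZMod.natCast_self, add_zero]
  have hbound : ∀ N, ‖g N‖ ≤ q := by
    intro N
    induction N using Nat.strong_induction_on with
    | _ N ih =>
      rcases lt_or_ge N q with h | h
      · calc ‖g N‖ ≤ ∑ n ∈ Finset.range N, ‖χ ((n + 1 : ℕ) : ZMod q)‖ := norm_sum_le _ _
          _ ≤ ∑ n ∈ Finset.range N, (1 : ℝ) := Finset.sum_le_sum fun n _ => χ.norm_le_one _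
          _ = N := by simp
          _ ≤ q := by exact_mod_cast h.le
      · have h1 := hper (N - q)
        rw [Nat.sub_add_cancel h] at h1
        rw [h1]
        exact ih _ (Nat.sub_lt ((NeZero.pos q).trans_le h) (NeZero.pos q))
  have h1 : charSum χ x = g ⌊x⌋₊ := by
    simp only [charSum, hg]
    rw [Finset.range_eq_Ico, ← Finset.Ico_add_one_right_eq_Icc,
      Finset.sum_Ico_add' (fun n : ℕ => χ (n : ZMod q)) 0 ⌊x⌋₊ 1, Nat.zero_add]
  rw [h1]
  exact hbound _

theorem exists_ne_one_dirichletCharacter {q : ℕ} (hq : 3 ≤ q) :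
    ∃ χ : DirichletCharacter ℂ q, χ ≠ 1 := by
  have : NeZero q := ⟨by omega⟩
  have : Fact (2 < q) := ⟨hq⟩
  obtain ⟨χ, hχ⟩ := DirichletCharacter.exists_apply_ne_one_of_hasEnoughRootsOfUnity ℂ
    (ZMod.neg_one_ne_one (n := q))
  refine ⟨χ, fun h => hχ ?_⟩
  rw [h]
  exact MulChar.one_apply isUnit_one.neg

theorem charSum_one {q : ℕ} (χ : DirichletCharacter ℂ q) : charSum χ 1 = 1 := by
  simp [charSum]

theorem one_mem_normalizedCharSums {q : ℕ} (hq : 3 ≤ q) : 1 ∈ normalizedCharSums q := by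
  obtain ⟨χ, hχ⟩ := exists_ne_one_dirichletCharacter hq
  exact ⟨χ, hχ, 1, le_rfl, by simp [charSum_one]⟩

/-- Rounding x down to an integer only increases the quotient. Once ⌊x⌋ > q² it is at most q/√x ≤ 1,
a value already attained at x = 1, so finitely many pairs (χ, n) matter. -/
theorem exists_isGreatest_normalizedCharSums {q : ℕ} (hq : 3 ≤ q) :
    ∃ M, IsGreatest (normalizedCharSums q) M := by
  have : NeZero q := ⟨by omega⟩
  set F : Set ℝ := (fun p : DirichletCharacter ℂ q × ℕ => ‖charSum p.1 p.2‖ / √(p.2 : ℝ)) ''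
    {p | p.1 ≠ 1 ∧ p.2 ∈ Set.Icc 1 (q ^ 2)} with hF
  have hfin : F.Finite := by
    refine Set.Finite.image _ (Set.Finite.subset
      (Set.finite_univ.prod (Set.finite_Icc 1 (q ^ 2))) fun p hp => ⟨Set.mem_univ _, hp.2⟩)
  have h1 : (1 : ℝ) ∈ F := by
    obtain ⟨χ, hχ⟩ := exists_ne_one_dirichletCharacter hq
    refine ⟨(χ, 1), ⟨hχ, le_rfl, Nat.one_le_pow _ _ (by omega)⟩, by simp [charSum_one]⟩
  obtain ⟨M, hM, hmax⟩ := hfin.exists_maximal ⟨1, h1⟩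
  have hmax' : ∀ r ∈ F, r ≤ M := fun r hr => by
    rcases le_total r M with h | h
    · exact h
    · exact hmax hr h
  refine ⟨M, ?_, ?_⟩
  · obtain ⟨⟨χ, n⟩, ⟨hχ, hn⟩, rfl⟩ := hM
    exact ⟨χ, hχ, n, by exact_mod_cast hn.1, rfl⟩
  · rintro r ⟨χ, hχ, x, hx, rfl⟩
    have hfl : charSum χ x = charSum χ (⌊x⌋₊ : ℝ) := by simp [charSum]
    rcases le_or_gt ⌊x⌋₊ (q ^ 2) with h | h
    · have hn : 1 ≤ ⌊x⌋₊ := Nat.le_floor (by exact_mod_cast hx)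
      refine le_trans ?_ (hmax' _ ⟨(χ, ⌊x⌋₊), ⟨hχ, hn, h⟩, rfl⟩)
      have hpos : (0 : ℝ) < ⌊x⌋₊ := by exact_mod_cast hn
      simp only [hfl]
      gcongr
      exact Nat.floor_le (by linarith)
    · refine le_trans ?_ (hmax' 1 h1)
      have h2 : ((q : ℝ)) ^ 2 ≤ x :=
        le_trans (by exact_mod_cast h.le) (Nat.floor_le (by linarith : 0 ≤ x))
      have h3 : (q : ℝ) ≤ √x := Real.le_sqrt_of_sq_le h2
      rw [div_le_one (Real.sqrt_pos.2 (by linarith))]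
      exact (norm_charSum_le_modulus hχ x).trans h3

/-! ### Conclusion -/

theorem eventually_mul_log_rpow_le_sqrt (G s : ℝ) :
    ∀ᶠ y : ℝ in Filter.atTop, G * Real.log y ^ s ≤ √y := by
  have h := (isLittleO_log_rpow_rpow_atTop s (by norm_num : (0 : ℝ) < 1 / 2)).const_mul_left G
  filter_upwards [h.def one_pos] with y hy
  rw [one_mul, ← Real.sqrt_eq_rpow, Real.norm_eq_abs, Real.norm_eq_abs,
    abs_of_nonneg (Real.sqrt_nonneg _)] at hy
  exact (le_abs_self _).trans hy

theorem exists_charSum_ge : ∀ A : ℝ, 0 < A → ∃ q₀ : ℕ, ∀ q : ℕ, q₀ ≤ q →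
    ∀ τ η x : ℝ,
      (Real.log (Real.log q)) ^ (-A) ≤ τ → τ ≤ (Real.log (Real.log q)) ^ A →
      η = τ + 1 / τ →
      0 < x → Real.log x = τ * √(Real.log q * Real.log (Real.log q)) →
      ∃ χ : DirichletCharacter ℂ q, χ ≠ 1 ∧
        1 / 4 * Real.exp (1 / 13440192 * ((1 + Real.log (η * τ)) / η) *
            √(Real.log q / Real.log (Real.log q))) ≤
          ‖charSum χ x‖ / √x := by
  intro A hA
  obtain ⟨i₀, hi₀⟩ := exists_primeBlock_card_ge
  have t1 : Filter.Tendsto (fun q : ℕ => Real.log q) Filter.atTop Filter.atTop :=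
    Real.tendsto_log_atTop.comp tendsto_natCast_atTop_atTop
  have t2 := Real.tendsto_log_atTop.comp t1
  obtain ⟨q₀, hq₀⟩ := Filter.eventually_atTop.1 (((t2.eventually_ge_atTop 1).and
    (t2.eventually_ge_atTop (i₀ : ℝ))).and ((t1.eventually
      (eventually_mul_log_rpow_le_sqrt (4608 * 70001 ^ 3) (A * 10 + 3))).and
        (Filter.eventually_ge_atTop 4)))
  refine ⟨q₀, fun q hq τ η x hτ1 hτ2 hη hx0 hx => ?_⟩
  obtain ⟨⟨hℓ, hℓi⟩, hbig, hq4⟩ := hq₀ q hq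
  simp only [Function.comp_apply] at hℓ hℓi
  have : NeZero q := ⟨by omega⟩
  set ℓ := Real.log (Real.log q) with hℓdef
  have hℓ0 : 0 < ℓ := one_pos.trans_le hℓ
  have hτ0 : 0 < τ := lt_of_lt_of_le (Real.rpow_pos_of_pos hℓ0 _) hτ1
  by_contra! hcon
  have hsx : 0 < √x := Real.sqrt_pos.2 hx0
  set E := Real.exp (1 / 13440192 * ((1 + Real.log (η * τ)) / η) * √(Real.log q / ℓ)) with hE
  have hE0 : 0 < E := Real.exp_pos _
  -- With `Y` = √x·E/4 the conclusion √x·E/2 ≤ `Y` is absurd.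
  have := charSum_bound_ge_of_large (q := q) (i₀ := i₀) (fun i hi => hi₀ i hi q (by omega))
    (τ := τ) (η := η) (x := x) (T := ℓ ^ A) (Y := √x * E / 4) hq4 hℓ hℓi hτ0 hτ2
    (Real.one_le_rpow hℓ hA.le)
    (by
      calc (1 : ℝ) = ℓ ^ (-A) * ℓ ^ A := by
            rw [← Real.rpow_add hℓ0, neg_add_cancel, Real.rpow_zero]
        _ ≤ τ * ℓ ^ A := by gcongr)
    (by
      refine le_of_eq_of_le ?_ hbig
      rw [Real.rpow_add hℓ0, Real.rpow_mul hℓ0.le]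
      norm_cast)
    hη hx0 hx (by positivity)
    (fun χ hχ => by
      have h1 := (div_lt_iff₀ hsx).1 (hcon χ hχ)
      linarith)
  have hpos : 0 < √x * E := by positivity
  linarith

theorem theorem5 :
    (∃ c : ℝ, 0 < c ∧ ∃ C : ℝ, 0 < C ∧ ∀ A : ℝ, 0 < A → ∃ q₀ : ℕ, ∀ q : ℕ, q₀ ≤ q →
      ∀ τ η x : ℝ,
        (Real.log (Real.log q)) ^ (-A) ≤ τ → τ ≤ (Real.log (Real.log q)) ^ A →
        η = τ + 1 / τ →
        0 < x → Real.log x = τ * √(Real.log q * Real.log (Real.log q)) →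
        ∃ χ : DirichletCharacter ℂ q, χ ≠ 1 ∧
          C * Real.exp (c * ((1 + Real.log (η * τ)) / η) *
              √(Real.log q / Real.log (Real.log q))) ≤
            ‖charSum χ x‖ / √x) ∧
    (∃ c : ℝ, 0 < c ∧ ∃ C : ℝ, 0 < C ∧ ∀ q : ℕ, 3 ≤ q →
      ∃ M : ℝ, IsGreatest (normalizedCharSums q) M ∧
        C * Real.exp (c * √(Real.log q / Real.log (Real.log q))) ≤ M) := by
  refine ⟨⟨1 / 13440192, by norm_num, 1 / 4, by norm_num, exists_charSum_ge⟩,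
    ⟨1 / 26880384, by norm_num, ?_⟩⟩
  obtain ⟨q₀, hq₀⟩ := exists_charSum_ge 1 one_pos
  have t : Filter.Tendsto (fun q : ℕ => Real.log (Real.log q)) Filter.atTop Filter.atTop :=
    Real.tendsto_log_atTop.comp (Real.tendsto_log_atTop.comp tendsto_natCast_atTop_atTop)
  obtain ⟨q₁, hq₁⟩ := Filter.eventually_atTop.1
    ((t.eventually_ge_atTop 1).and (Filter.eventually_ge_atTop q₀))
  set f : ℕ → ℝ := fun q =>
    Real.exp (1 / 26880384 * √(Real.log q / Real.log (Real.log q))) with hf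
  have hf0 : ∀ q, 0 < f q := fun q => Real.exp_pos _
  -- The sum absorbs the finitely many small q, where the value 1 at x = 1 is enough; the 4 matches
  -- the constant of part (i).
  set B := 4 + ∑ q ∈ Finset.range q₁, f q with hB
  have hsum : 0 ≤ ∑ q ∈ Finset.range q₁, f q := Finset.sum_nonneg fun q _ => (hf0 q).le
  have hB0 : 0 < B := by linarith
  refine ⟨1 / B, by positivity, fun q hq => ?_⟩
  obtain ⟨M, hM⟩ := exists_isGreatest_normalizedCharSums hq
  refine ⟨M, hM, ?_⟩
  change 1 / B * f q ≤ M
  rcases lt_or_ge q q₁ with hlt | hge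
  · refine le_trans ?_ (hM.2 (one_mem_normalizedCharSums hq))
    rw [one_div_mul_eq_div, div_le_one hB0]
    have := Finset.single_le_sum (fun q _ => (hf0 q).le) (Finset.mem_range.2 hlt)
    linarith
  · obtain ⟨hℓ, hq0⟩ := hq₁ q hge
    set r := √(Real.log q * Real.log (Real.log q)) with hr
    -- τ = 1, η = 2: dropping log 2 ≥ 0 leaves the exponent constant halved.
    obtain ⟨χ, hχ, hle⟩ := hq₀ q hq0 1 2 (Real.exp r)
      (by
        rw [Real.rpow_neg_one]
        exact inv_le_one_of_one_le₀ hℓ)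
      (by rwa [Real.rpow_one]) (by norm_num) (Real.exp_pos _) (by rw [Real.log_exp, one_mul])
    have hx1 : 1 ≤ Real.exp r := Real.one_le_exp (Real.sqrt_nonneg _)
    refine le_trans ?_ (hM.2 ⟨χ, hχ, Real.exp r, hx1, rfl⟩)
    refine le_trans (mul_le_mul ?_ ?_ (hf0 q).le (by norm_num)) hle
    · apply one_div_le_one_div_of_le (by norm_num)
      linarith
    · apply Real.exp_le_exp.2
      have hlog : 0 ≤ Real.log (2 * 1) := Real.log_nonneg (by norm_num)
      have := Real.sqrt_nonneg (Real.log q / Real.log (Real.log q))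
      nlinarith [mul_nonneg hlog this]
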